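/- Fix an integer $d\ge 2$. Let $\mathcal E$ be the set of all $d$-element subsets (edges) of $[n]$, $n\ge d$. For a map $\Phi^*:[n]\to[k]$ (its fibres are the communities) and $0\le q_n<p_n\le 1$, the model $d$-WHSBM$(n,k,p_n,q_n,\Phi^*)$ assigns to the edges $e\in\mathcal E$ independent random weights $W_e\in[0,1]$ with $\mathbb E[W_e]=p_n$ if $e$ is contained in one community and $\mathbb E[W_e]=q_n$ otherwise. Its similarity matrix $\mathbf A\in\mathbb R^{n\times n}$ has the entries $\mathbf A_{ij}=\sum_{e\supseteq\{i,j\}}W_e$ for $i\ne j$ and $\mathbf A_{ii}=0$. The model is balanced if all communities have the same size $s=n/k$. Let $$p_n^-=\min\{\mathbb E[\mathbf A_{ij}]: i\neq j,\ \Phi^*(i)=\Phi^*(j)\},\qquad q_n^+=\max\{\mathbb E[\mathbf A_{ij}]:\Phi^*(i)\ne\Phi^*(j)\}.$$ *Estimators.* Let $\hat\lambda_1\ge\dots\ge\hat\lambda_n$ be the eigenvalues of $\mathbf A$. Let $\hat k$ be a (measurable) random element of $\arg\max\{\hat\lambda_i-\hat\lambda_{i+1}: 2\le i\le n-1\}$,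 ties being broken in any way (for instance uniformly at random), and put $$\hat s=\frac n{\hat k},\qquad \hat p_n^-=\frac{\hat s\hat\lambda_1+(n-\hat s)\hat\lambda_2}{n(\hat s-1)},\qquad \hat q_n^+=\frac{\hat\lambda_1-\hat\lambda_2}{n},\qquad \hat\lambda=\frac{\hat p_n^-+\hat q_n^+}{2}.$$ **Theorem 4.2.** For every $d\ge2$ there are constants $c_5,c_2>0$, depending only on $d$, with the following properties. (a) $c_5$ is a constant for the spectral norm bound: for all $n\ge d$, $k$, $0\le q_n<p_n\le1$ and $\Phi^*$ (balanced or not) with $n\binom{n-2}{d-2}p_n\ge\log n$, with probability exceeding $1-4n^{-11}$, $$\|\mathbf A-\mathbb E[\mathbf A]\|\le c_5\sqrt{n\tbinom{n-2}{d-2}p_n}.$$ (b) For all $n\ge d$, $k\ge2$, $0\le q_n<p_n\le1$ and every balanced $d$-WHSBM$(n,k,p_n,q_n,\Phi^*)$ with communities of size $s$ such that $$s^2\binom{s-2}{d-2}^2(p_n-q_n)^2\ \ge\ c_2\binom{n-2}{d-2}p_n\,(s\log n+n),$$ the following hold simultaneously with probability exceeding $1-4n^{-11}$: 1. $\hat k=k$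 and $\hat s=s$; 2. $\max\{|\hat p_n^--p_n^-|,\,|\hat q_n^+-q_n^+|\}\le\dfrac{2c_5}{s}\sqrt{n\binom{n-2}{d-2}p_n}$; 3. $\hat\lambda\in\left[\tfrac14p_n^-+\tfrac34q_n^+,\ \tfrac34p_n^-+\tfrac14q_n^+\right]$. -/

import Mathlib

open MeasureTheory ProbabilityTheory

universe u

namespace WHSBM

/-- The `d`-regular edges on the vertex set `[n]`: the `d`-element subsets. -/
abbrev Edge (n d : ℕ) : Type := {e : Finset (Fin n) // e.card = d}

/-- An edge is `Φ`-homogeneous if all its vertices lie in the same community. -/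
def Homogeneous {n d k : ℕ} (Φ : Fin n → Fin k) (e : Edge n d) : Prop :=
  ∀ i ∈ e.1, ∀ j ∈ e.1, Φ i = Φ j

/-- The random weights `W` on `(Ω, μ)` are a sample of the weighted `d`-uniform hypergraph
stochastic block model with parameters `(n, k, p, q, Φ)`: independent weights in `[0, 1]`, of mean
`p` on homogeneous edges and of mean `q` on the other ones. -/
structure IsSample {Ω : Type*} [MeasurableSpace Ω] (μ : Measure Ω) {n d k : ℕ} (p q : ℝ)
    (Φ : Fin n → Fin k) (W : Edge n d → Ω → ℝ) : Prop where
  measurable : ∀ e, Measurable (W e)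
  mem_Icc : ∀ e ω, W e ω ∈ Set.Icc (0 : ℝ) 1
  indep : iIndepFun W μ
  mean_homogeneous : ∀ e, Homogeneous Φ e → ∫ ω, W e ω ∂μ = p
  mean_heterogeneous : ∀ e, ¬ Homogeneous Φ e → ∫ ω, W e ω ∂μ = q

/-- The model is balanced with community size `s`: every community has exactly `s` nodes. -/
def Balanced {n k : ℕ} (Φ : Fin n → Fin k) (s : ℕ) : Prop :=
  ∀ a : Fin k, (Finset.univ.filter fun i => Φ i = a).card = s

/-- The similarity matrix of a weighted hypergraph. -/
def similarity {n d : ℕ} (w : Edge n d → ℝ) : Matrix (Fin n) (Fin n) ℝ :=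
  Matrix.of fun i j =>
    if i = j then 0 else ∑ e ∈ Finset.univ.filter (fun e : Edge n d => i ∈ e.1 ∧ j ∈ e.1), w e

theorem similarity_isHermitian {n d : ℕ} (w : Edge n d → ℝ) : (similarity w).IsHermitian := by
  refine Matrix.IsHermitian.ext fun i j => ?_
  simp only [similarity, Matrix.of_apply, star_trivial]
  by_cases h : i = j
  · simp [h]
  · rw [if_neg h, if_neg (Ne.symm h)]
    exact congrArg (fun S : Finset (Edge n d) => ∑ e ∈ S, w e)
      (Finset.filter_congr fun e _ => and_comm)

/-- The entrywise expectation of the similarity matrix. -/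
noncomputable def meanSimilarity {Ω : Type*} [MeasurableSpace Ω] (μ : Measure Ω) {n d : ℕ}
    (W : Edge n d → Ω → ℝ) : Matrix (Fin n) (Fin n) ℝ :=
  Matrix.of fun i j => ∫ ω, similarity (fun e => W e ω) i j ∂μ

/-- The minimum within-cluster similarity `p_n^-`: the minimum of the expected similarities of
pairs of distinct nodes of the same community. -/
noncomputable def minWithin {Ω : Type*} [MeasurableSpace Ω] (μ : Measure Ω) {n d k : ℕ}
    (Φ : Fin n → Fin k) (W : Edge n d → Ω → ℝ) : ℝ :=
  ⨅ x : {x : Fin n × Fin n // x.1 ≠ x.2 ∧ Φ x.1 = Φ x.2}, meanSimilarity μ W x.1.1 x.1.2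

/-- The maximum cross-cluster similarity `q_n^+`: the maximum of the expected similarities of
pairs of nodes of different communities. -/
noncomputable def maxCross {Ω : Type*} [MeasurableSpace Ω] (μ : Measure Ω) {n d k : ℕ}
    (Φ : Fin n → Fin k) (W : Edge n d → Ω → ℝ) : ℝ :=
  ⨆ x : {x : Fin n × Fin n // Φ x.1 ≠ Φ x.2}, meanSimilarity μ W x.1.1 x.1.2

/-- The spectral norm: the operator norm on Euclidean space. -/
noncomputable def spectralNorm {n : ℕ} (M : Matrix (Fin n) (Fin n) ℝ) : ℝ :=
  ‖Matrix.toEuclideanCLM (n := Fin n) (𝕜 := ℝ) M‖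

/-- The `i`-th largest eigenvalue, with multiplicity, for `1 ≤ i ≤ n` (and `0` for other `i`). -/
noncomputable def eig {n : ℕ} {A : Matrix (Fin n) (Fin n) ℝ} (hA : A.IsHermitian) (i : ℕ) : ℝ :=
  if h : 1 ≤ i ∧ i ≤ n then
    hA.eigenvalues₀ ⟨i - 1, by rw [Fintype.card_fin]; omega⟩
  else 0

/-- The set of maximizers of the eigen-gap `λ_i - λ_{i+1}` over `i ∈ {2, …, n - 1}`. -/
def gapArgmax {n : ℕ} {A : Matrix (Fin n) (Fin n) ℝ} (hA : A.IsHermitian) : Set ℕ :=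
  {i | i ∈ Finset.Icc 2 (n - 1) ∧
    ∀ j ∈ Finset.Icc 2 (n - 1), eig hA j - eig hA (j + 1) ≤ eig hA i - eig hA (i + 1)}

/-- The estimated community size `n / k̂`. -/
noncomputable def sHat (n kHat : ℕ) : ℝ := (n : ℝ) / kHat

/-- The estimator of `p_n^-`, from the matrix and the estimated number of communities. -/
noncomputable def pHat {n : ℕ} {A : Matrix (Fin n) (Fin n) ℝ} (hA : A.IsHermitian)
    (kHat : ℕ) : ℝ :=
  (sHat n kHat * eig hA 1 + (n - sHat n kHat) * eig hA 2) / (n * (sHat n kHat - 1))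

/-- The estimator of `q_n^+`. -/
noncomputable def qHat {n : ℕ} {A : Matrix (Fin n) (Fin n) ℝ} (hA : A.IsHermitian) : ℝ :=
  (eig hA 1 - eig hA 2) / n

/-- The estimator of the tuning parameter. -/
noncomputable def lambdaHat {n : ℕ} {A : Matrix (Fin n) (Fin n) ℝ} (hA : A.IsHermitian)
    (kHat : ℕ) : ℝ :=
  (pHat hA kHat + qHat hA) / 2

/-- The density-gap condition with constant `c`, where `s` is the minimum community size. -/
def GapCondition (c : ℝ) (n d s : ℕ) (p q : ℝ) : Prop :=
  c * (((n - 2).choose (d - 2) : ℝ) * p * (s * Real.log n + n)) ≤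
    (s : ℝ) ^ 2 * ((s - 2).choose (d - 2) : ℝ) ^ 2 * (p - q) ^ 2

/-- `c` is an admissible constant in the spectral concentration bound
`‖A - 𝔼 A‖ ≤ c √(n C(n-2,d-2) p)`, with probability exceeding `1 - 4 n⁻¹¹`, for all assortative
models on `d`-uniform hypergraphs such that `n C(n-2,d-2) p ≥ α log n`. -/
def IsSpectralConstant (d : ℕ) (α c : ℝ) : Prop :=
  ∀ (n k : ℕ) (p q : ℝ) (Φ : Fin n → Fin k) (Ω : Type u) [MeasurableSpace Ω] (μ : Measure Ω)
    [IsProbabilityMeasure μ] (W : Edge n d → Ω → ℝ),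
    d ≤ n → 0 ≤ q → q < p → p ≤ 1 → IsSample μ p q Φ W →
    α * Real.log n ≤ n * ((n - 2).choose (d - 2) : ℝ) * p →
    1 - 4 * ((n : ℝ) ^ 11)⁻¹ <
      μ.real {ω | spectralNorm (similarity (fun e => W e ω) - meanSimilarity μ W) ≤
        c * √(n * ((n - 2).choose (d - 2) : ℝ) * p)}

end WHSBM

/-! The expected similarity matrix of a balanced model has zero diagonal, entries `Δ + Q` within
communities and `Q` across them, where `Δ = C(s-2,d-2)(p-q)` and `Q = C(n-2,d-2) q`. Its eigenvalues
are `sΔ + nQ - (Δ+Q)` once, `sΔ - (Δ+Q)` with multiplicity `k - 1`, and `-(Δ+Q)` with multiplicity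
`n - k`. The estimators invert these formulas exactly. A perturbation of spectral norm at most `δ =
c₅√D`, `D = n C(n-2,d-2) p`, moves each eigenvalue by at most `δ`, and the density gap gives `8δ ≤
sΔ`. So the gap at `k` is at least `6δ`, every other admissible gap is at most `2δ`, and the
estimators inherit errors of order `δ/s` (`estimators_of_nearBlockForm`).

The spectral bound (`isSpectralConstant_spectralConst`) follows the method of
Friedman–Kahn–Szemerédi and Feige–Ofek. On a finite net it suffices to bound `∑ x_i y_j (A -
𝔼A)_ij`. Light pairs, with `|x_i y_j| ≤ 3√D/n`, obey Bernstein's inequality and a union bound over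
the net. Heavy pairs are controlled deterministically (`sum_heavy_le`) once all degrees are `O(D)`
and no submatrix is too dense (discrepancy); both properties come from Chernoff bounds. The entries
of `A` are dependent, since one edge feeds many entries. Every linear form in the entries is
therefore rewritten as a sum over edges with independent weights (`sum_mul_similarity`), at the cost
of factors `d²`. -/

namespace WHSBM

/-! ### Nets, operator norms and the min-max principle for eigenvalues -/

section LinearAlgebra

open Module

/-- The unit ball of a finite-dimensional real normed space has a `1/2`-net of at most `5 ^ dim`
points. -/
theorem exists_half_net (E : Type*) [NormedAddCommGroup E] [NormedSpace ℝ E]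
    [FiniteDimensional ℝ E] :
    ∃ s : Finset E, s.card ≤ 5 ^ finrank ℝ E ∧ (∀ c ∈ s, ‖c‖ ≤ 1) ∧
      ∀ x : E, ‖x‖ ≤ 1 → ∃ c ∈ s, ‖x - c‖ ≤ 1 / 2 := by
  classical
  let P : Finset E → Prop := fun s =>
    (∀ c ∈ s, ‖c‖ ≤ 1) ∧ ∀ c ∈ s, ∀ e ∈ s, c ≠ e → 1 / 2 ≤ ‖c - e‖
  have hcard : ∀ s, P s → s.card ≤ 5 ^ finrank ℝ E := by
    intro s hs
    -- Doubling turns `1/2`-separated points of the unit ball into `1`-separated points of the ball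
    -- of radius 2, for which the volume bound is `5 ^ dim`.
    have hinj : Function.Injective fun x : E => (2 : ℝ) • x := smul_right_injective E two_ne_zero
    rw [← Finset.card_image_of_injective s hinj]
    apply Besicovitch.card_le_of_separated
    · intro c hc
      obtain ⟨x, hx, rfl⟩ := Finset.mem_image.1 hc
      have := hs.1 x hx
      simp only [norm_smul, Real.norm_ofNat]
      linarith
    · intro c hc e he hce
      obtain ⟨x, hx, rfl⟩ := Finset.mem_image.1 hc
      obtain ⟨y, hy, rfl⟩ := Finset.mem_image.1 he
      have hxy : x ≠ y := fun h => hce (by rw [h])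
      have := hs.2 x hx y hy hxy
      simp only [← smul_sub, norm_smul, Real.norm_ofNat]
      linarith
  -- A separated set of maximal cardinality is a net: a point far from all its members could be
  -- added.
  let C : Set ℕ := {m | ∃ s, P s ∧ s.card = m}
  have hbdd : BddAbove C := ⟨5 ^ finrank ℝ E, by rintro m ⟨s, hs, rfl⟩; exact hcard s hs⟩
  have hne : C.Nonempty := ⟨0, ∅, by simp [P], rfl⟩
  obtain ⟨s, hs, hsc⟩ := Nat.sSup_mem hne hbdd
  refine ⟨s, hcard s hs, hs.1, fun x hx => ?_⟩
  by_contra! h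
  have hxs : x ∉ s := fun hxs => by have := h x hxs; norm_num at this
  have hins : P (insert x s) := by
    refine ⟨?_, ?_⟩
    · intro c hc
      rcases Finset.mem_insert.1 hc with rfl | hc
      · exact hx
      · exact hs.1 c hc
    · intro c hc e he hce
      rcases Finset.mem_insert.1 hc with hcx | hcs <;>
        rcases Finset.mem_insert.1 he with hex | hes
      · exact absurd (hcx.trans hex.symm) hce
      · rw [hcx]; exact (h e hes).le
      · rw [hex, norm_sub_rev]; exact (h c hcs).le
      · exact hs.2 c hcs e hes hce
  have := le_csSup hbdd ⟨insert x s, hins, rfl⟩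
  rw [Finset.card_insert_of_notMem hxs, ← hsc] at this
  omega

/-- Testing `v` against a net point near `v / ‖v‖` loses at most `‖v‖ / 2`, which is absorbed on the
left. -/
theorem norm_le_of_half_net {E : Type*} [NormedAddCommGroup E] [InnerProductSpace ℝ E]
    {s : Finset E} (hs : ∀ x : E, ‖x‖ ≤ 1 → ∃ c ∈ s, ‖x - c‖ ≤ 1 / 2) {v : E} {τ : ℝ}
    (h : ∀ x ∈ s, inner ℝ x v ≤ τ) : ‖v‖ ≤ 2 * τ := by
  rcases eq_or_ne v 0 with rfl | hv
  · obtain ⟨c, hc, -⟩ := hs 0 (by simp)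
    have := h c hc
    simp only [inner_zero_right] at this
    simpa using this
  have hv' : 0 < ‖v‖ := norm_pos_iff.2 hv
  have hw : ‖(‖v‖⁻¹ : ℝ) • v‖ = 1 := by
    rw [norm_smul, norm_inv, norm_norm, inv_mul_cancel₀ hv'.ne']
  obtain ⟨c, hc, hcw⟩ := hs ((‖v‖⁻¹ : ℝ) • v) hw.le
  have h1 : inner ℝ ((‖v‖⁻¹ : ℝ) • v) v = ‖v‖ := by
    rw [real_inner_smul_left, real_inner_self_eq_norm_sq]
    field_simp
  have h2 : inner ℝ ((‖v‖⁻¹ : ℝ) • v - c) v ≤ 1 / 2 * ‖v‖ :=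
    (real_inner_le_norm _ _).trans (by gcongr)
  rw [inner_sub_left, h1] at h2
  linarith [h c hc]

/-- The absorption argument is applied once per argument of the bilinear form, and each costs a
factor 2. -/
theorem opNorm_le_of_half_net {E : Type*} [NormedAddCommGroup E] [InnerProductSpace ℝ E]
    {s : Finset E} (hs : ∀ x : E, ‖x‖ ≤ 1 → ∃ c ∈ s, ‖x - c‖ ≤ 1 / 2) {T : E →L[ℝ] E} {τ : ℝ}
    (h : ∀ x ∈ s, ∀ y ∈ s, inner ℝ x (T y) ≤ τ) : ‖T‖ ≤ 4 * τ := by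
  have h1 : ∀ y ∈ s, ‖T y‖ ≤ 2 * τ := fun y hy => norm_le_of_half_net hs fun x hx => h x hx y hy
  have h0 : 0 ≤ 2 * τ := by
    obtain ⟨c, hc, -⟩ := hs 0 (by simp)
    exact (norm_nonneg _).trans (h1 c hc)
  suffices ‖T‖ ≤ 2 * τ + ‖T‖ * (1 / 2) by linarith
  refine ContinuousLinearMap.opNorm_le_of_unit_norm (by positivity) fun x hx => ?_
  obtain ⟨c, hc, hcx⟩ := hs x hx.le
  calc ‖T x‖ = ‖T c + T (x - c)‖ := by rw [← map_add]; simp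
    _ ≤ ‖T c‖ + ‖T (x - c)‖ := norm_add_le _ _
    _ ≤ 2 * τ + ‖T‖ * (1 / 2) := by
      gcongr
      · exact h1 c hc
      · exact (T.le_opNorm _).trans (by gcongr)

/-- The coordinates of a vector in an orthonormal eigenbasis diagonalize the quadratic form. -/
theorem exists_diagonalization {n : ℕ} {A : Matrix (Fin n) (Fin n) ℝ} (hA : A.IsHermitian) :
    ∃ b : OrthonormalBasis (Fin n) ℝ (EuclideanSpace ℝ (Fin n)),
      ∀ x, inner ℝ x (Matrix.toEuclideanCLM (n := Fin n) (𝕜 := ℝ) A x) =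
        ∑ j : Fin n, eig hA (j + 1) * b.repr x j ^ 2 := by
  have hT := Matrix.isSymmetric_toEuclideanLin_iff.mpr hA
  let e : Fin (Fintype.card (Fin n)) ≃ Fin n := finCongr (Fintype.card_fin n)
  refine ⟨(hT.eigenvectorBasis finrank_euclideanSpace).reindex e, fun x => ?_⟩
  set b := hT.eigenvectorBasis finrank_euclideanSpace with hb
  rw [← (b.reindex e).repr.inner_map_map]
  simp only [PiLp.inner_apply]
  refine Finset.sum_congr rfl fun j _ => ?_
  have h0 : ∀ y, (b.reindex e).repr y j = b.repr y (e.symm j) := fun y => by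
    simp [OrthonormalBasis.repr_apply_apply]
  have h1 : b.repr (Matrix.toEuclideanCLM (n := Fin n) (𝕜 := ℝ) A x) (e.symm j) =
      hA.eigenvalues₀ (e.symm j) * b.repr x (e.symm j) :=
    hT.eigenvectorBasis_apply_self_apply finrank_euclideanSpace x (e.symm j)
  have h2 : eig hA (j + 1) = hA.eigenvalues₀ (e.symm j) := by
    rw [eig, dif_pos ⟨by omega, by omega⟩]
    rfl
  rw [h0, h0, h1, h2]
  simp
  ring

theorem eig_antitone {n : ℕ} {A : Matrix (Fin n) (Fin n) ℝ} (hA : A.IsHermitian) {i j : ℕ}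
    (hi : 1 ≤ i) (hij : i ≤ j) (hj : j ≤ n) : eig hA j ≤ eig hA i := by
  rw [eig, eig, dif_pos ⟨by omega, by omega⟩, dif_pos ⟨by omega, by omega⟩]
  apply hA.eigenvalues₀_antitone
  simp only [Fin.mk_le_mk]
  omega

/-- If the quadratic form of `A` is at most `c ‖x‖²` on the kernel of a linear map into a space of
dimension less than `i`, then the `i`-th largest eigenvalue is at most `c`. -/
theorem eig_le_of_ker {n : ℕ} {A : Matrix (Fin n) (Fin n) ℝ} (hA : A.IsHermitian) {i : ℕ}
    (hin : i ≤ n) {F : Type*} [AddCommGroup F] [Module ℝ F] [FiniteDimensional ℝ F]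
    (f : EuclideanSpace ℝ (Fin n) →ₗ[ℝ] F) (hF : finrank ℝ F < i) {c : ℝ}
    (h : ∀ x, f x = 0 →
      inner ℝ x (Matrix.toEuclideanCLM (n := Fin n) (𝕜 := ℝ) A x) ≤ c * ‖x‖ ^ 2) :
    eig hA i ≤ c := by
  obtain ⟨b, hb⟩ := exists_diagonalization hA
  -- `g` reads the coordinates along the `n - i` lowest eigenvectors. As `dim F + (n - i) < n`, some
  -- nonzero `x` is killed by both `f` and `g`, and on it the form is at least `eig hA i * ‖x‖ ^ 2`.
  let g : EuclideanSpace ℝ (Fin n) →ₗ[ℝ] (Fin (n - i) → ℝ) :=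
    { toFun := fun x j => b.repr x ⟨i + j, by omega⟩
      map_add' := fun x y => by ext; simp
      map_smul' := fun r x => by ext; simp }
  obtain ⟨x, hx, hx0⟩ := Submodule.exists_mem_ne_zero_of_ne_bot
    (LinearMap.ker_ne_bot_of_finrank_lt (f := f.prod g) (by
      rw [finrank_prod, finrank_euclideanSpace, finrank_fintype_fun_eq_card, Fintype.card_fin,
        Fintype.card_fin]; omega))
  replace hx : f x = 0 ∧ g x = 0 := Prod.mk_eq_zero.1 (LinearMap.mem_ker.1 hx)
  have hg : ∀ j : Fin n, i ≤ j → b.repr x j = 0 := fun j hj => by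
    have := congrFun hx.2 ⟨j - i, by omega⟩
    simp only [g, LinearMap.coe_mk, AddHom.coe_mk, Pi.zero_apply] at this
    have hj' : (⟨i + (j - i), by omega⟩ : Fin n) = j := Fin.ext (by simp; omega)
    rwa [hj'] at this
  have hnorm : ‖x‖ ^ 2 = ∑ j, b.repr x j ^ 2 := by
    rw [← b.repr.norm_map, EuclideanSpace.real_norm_sq_eq]
  have hpos : 0 < ‖x‖ ^ 2 := by have := norm_pos_iff.2 hx0; positivity
  have h1 := h x hx.1
  rw [hb] at h1
  have h2 : eig hA i * ‖x‖ ^ 2 ≤ ∑ j : Fin n, eig hA (j + 1) * b.repr x j ^ 2 := by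
    rw [hnorm, Finset.mul_sum]
    refine Finset.sum_le_sum fun j _ => ?_
    by_cases hj : i ≤ j
    · simp [hg j hj]
    · exact mul_le_mul_of_nonneg_right (eig_antitone hA (by omega) (by omega) hin) (sq_nonneg _)
  exact le_of_mul_le_mul_right (h2.trans h1) hpos

/-- If the quadratic form of `A` is at least `c ‖x‖²` on the image of an injective linear map from
a space of dimension at least `i`, then the `i`-th largest eigenvalue is at least `c`. -/
theorem le_eig_of_injective {n : ℕ} {A : Matrix (Fin n) (Fin n) ℝ} (hA : A.IsHermitian) {i : ℕ}
    (hi : 1 ≤ i) (hin : i ≤ n) {G : Type*} [AddCommGroup G] [Module ℝ G] [FiniteDimensional ℝ G]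
    (g : G →ₗ[ℝ] EuclideanSpace ℝ (Fin n)) (hg : Function.Injective g)
    (hG : i ≤ finrank ℝ G) {c : ℝ}
    (h : ∀ z, c * ‖g z‖ ^ 2 ≤
      inner ℝ (g z) (Matrix.toEuclideanCLM (n := Fin n) (𝕜 := ℝ) A (g z))) :
    c ≤ eig hA i := by
  obtain ⟨b, hb⟩ := exists_diagonalization hA
  -- Dually, some nonzero `z` has `g z` orthogonal to the top `i - 1` eigenvectors.
  let f : G →ₗ[ℝ] (Fin (i - 1) → ℝ) :=
    { toFun := fun z j => b.repr (g z) ⟨j, by omega⟩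
      map_add' := fun x y => by ext; simp
      map_smul' := fun r x => by ext; simp }
  obtain ⟨z, hz, hz0⟩ := Submodule.exists_mem_ne_zero_of_ne_bot
    (LinearMap.ker_ne_bot_of_finrank_lt (f := f) (by
      rw [finrank_fintype_fun_eq_card, Fintype.card_fin]; omega))
  rw [LinearMap.mem_ker] at hz
  have hf : ∀ j : Fin n, (j : ℕ) < i - 1 → b.repr (g z) j = 0 := fun j hj =>
    congrFun hz ⟨j, hj⟩
  have hx0 : g z ≠ 0 := fun h0 => hz0 (hg (by rw [h0, map_zero]))
  have hnorm : ‖g z‖ ^ 2 = ∑ j, b.repr (g z) j ^ 2 := by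
    rw [← b.repr.norm_map, EuclideanSpace.real_norm_sq_eq]
  have hpos : 0 < ‖g z‖ ^ 2 := by have := norm_pos_iff.2 hx0; positivity
  have h1 := h z
  rw [hb] at h1
  have h2 : ∑ j : Fin n, eig hA (j + 1) * b.repr (g z) j ^ 2 ≤ eig hA i * ‖g z‖ ^ 2 := by
    rw [hnorm, Finset.mul_sum]
    refine Finset.sum_le_sum fun j _ => ?_
    by_cases hj : (j : ℕ) < i - 1
    · simp [hf j hj]
    · exact mul_le_mul_of_nonneg_right (eig_antitone hA hi (by omega) (by omega)) (sq_nonneg _)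
  exact le_of_mul_le_mul_right (h1.trans h2) hpos

end LinearAlgebra

/-! ### Exponential tail bounds for sums of independent bounded variables -/

section Tail

variable {Ω ι : Type*} [MeasurableSpace Ω] {μ : Measure Ω} [IsProbabilityMeasure μ]

theorem integrable_of_mem_Icc {X : Ω → ℝ} (hX : Measurable X) {a b : ℝ}
    (h : ∀ ω, X ω ∈ Set.Icc a b) : Integrable X μ :=
  Integrable.of_mem_Icc a b hX.aemeasurable (Filter.Eventually.of_forall h)

theorem integrable_exp_mul_of_mem_Icc {X : Ω → ℝ} (hX : Measurable X) {a b t : ℝ} (ht : 0 ≤ t)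
    (h : ∀ ω, X ω ∈ Set.Icc a b) : Integrable (fun ω => Real.exp (t * X ω)) μ :=
  integrable_of_mem_Icc (a := 0) (b := Real.exp (t * b)) (by fun_prop) fun ω =>
    ⟨(Real.exp_pos _).le, Real.exp_le_exp.2 (mul_le_mul_of_nonneg_left (h ω).2 ht)⟩

/-- The chord of a convex function over `[0, 1]` lies above its graph. The bound is affine in `y`,
so only the mean of `y` enters the moment generating function. -/
theorem exp_mul_le_of_mem_Icc {y : ℝ} (hy : y ∈ Set.Icc (0 : ℝ) 1) (t : ℝ) :
    Real.exp (t * y) ≤ 1 + y * (Real.exp t - 1) := by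
  have := convexOn_exp.2 (Set.mem_univ 0) (Set.mem_univ t) (sub_nonneg.2 hy.2) hy.1 (by ring)
  simp only [smul_eq_mul, mul_zero, zero_add, Real.exp_zero] at this
  rw [mul_comm t y]
  linarith

/-- Chernoff's bound for a finite sum of independent bounded random variables, given bounds on the
moment generating functions of the summands. -/
theorem measureReal_sum_ge_le [Fintype ι] {X : ι → Ω → ℝ} (hX : ∀ e, Measurable (X e))
    (hindep : iIndepFun X μ) {a b : ι → ℝ} (hab : ∀ e ω, X e ω ∈ Set.Icc (a e) (b e)) {t : ℝ}
    (ht : 0 ≤ t) {v : ι → ℝ} (hv : ∀ e, ∫ ω, Real.exp (t * X e ω) ∂μ ≤ Real.exp (v e)) (r : ℝ) :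
    μ.real {ω | r ≤ ∑ e, X e ω} ≤ Real.exp (∑ e, v e - t * r) := by
  have h1 := measure_ge_le_exp_mul_mgf (μ := μ) (X := ∑ e, X e) (t := t) r ht
    (by
      refine integrable_exp_mul_of_mem_Icc (μ := μ) (X := ∑ e, X e) (a := ∑ e, a e)
        (b := ∑ e, b e) (by
          rw [Finset.sum_fn]; exact Finset.measurable_sum _ fun e _ => hX e) ht fun ω => ?_
      rw [Finset.sum_apply]
      exact ⟨Finset.sum_le_sum fun e _ => (hab e ω).1, Finset.sum_le_sum fun e _ => (hab e ω).2⟩)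
  simp only [Finset.sum_apply] at h1
  refine h1.trans ?_
  rw [hindep.mgf_sum hX, sub_eq_neg_add, Real.exp_add, Real.exp_sum, neg_mul]
  gcongr with e _
  · exact fun e _ => mgf_nonneg
  · exact hv e

variable {W : ι → Ω → ℝ} {p : ℝ}

/-- Bernstein's inequality for independent `[0, 1]`-valued random variables of mean at most `p`. -/
theorem measureReal_centered_sum_ge_le [Fintype ι] (hW : ∀ e, Measurable (W e))
    (hindep : iIndepFun W μ) (h01 : ∀ e ω, W e ω ∈ Set.Icc (0 : ℝ) 1)
    (hp : ∀ e, ∫ ω, W e ω ∂μ ≤ p) {c : ι → ℝ} {t : ℝ} (ht : 0 ≤ t)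
    (hc : ∀ e, t * |c e| ≤ 1) (r : ℝ) :
    μ.real {ω | r ≤ ∑ e, c e * (W e ω - ∫ ω, W e ω ∂μ)} ≤
      Real.exp (t ^ 2 * p * ∑ e, c e ^ 2 - t * r) := by
  have hmean : ∀ e, (∫ ω, W e ω ∂μ) ∈ Set.Icc (0 : ℝ) 1 := fun e =>
    ⟨integral_nonneg fun ω => (h01 e ω).1, by
      calc ∫ ω, W e ω ∂μ ≤ ∫ _, (1 : ℝ) ∂μ :=
            integral_mono (integrable_of_mem_Icc (hW e) (h01 e)) (integrable_const _)
              fun ω => (h01 e ω).2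
        _ = 1 := by simp⟩
  set w : ι → ℝ := fun e => ∫ ω, W e ω ∂μ with hw
  have habs : ∀ e ω, |c e * (W e ω - w e)| ≤ |c e| := fun e ω => by
    rw [abs_mul]
    refine mul_le_of_le_one_right (abs_nonneg _) (abs_le.2 ⟨?_, ?_⟩) <;>
      linarith [(h01 e ω).1, (h01 e ω).2, (hmean e).1, (hmean e).2]
  have hint := fun e => integrable_of_mem_Icc (μ := μ) (hW e) (h01 e)
  have hmeas : ∀ e, Measurable fun ω => c e * (W e ω - w e) := fun e =>
    ((hW e).sub_const _).const_mul _
  have hsq : ∀ e, Integrable (fun ω => (W e ω - w e) ^ 2) μ := fun e =>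
    integrable_of_mem_Icc (a := 0) (b := 1) (((hW e).sub_const _).pow_const 2) fun ω =>
      ⟨sq_nonneg _, by
        rw [sq_le_one_iff_abs_le_one, abs_le]
        constructor <;> linarith [(h01 e ω).1, (h01 e ω).2, (hmean e).1, (hmean e).2]⟩
  have hvar : ∀ e, ∫ ω, (W e ω - w e) ^ 2 ∂μ ≤ p := fun e => by
    have hi1 : Integrable (fun ω => 2 * w e * W e ω) μ := (hint e).const_mul _
    have hi2 : Integrable (fun ω => W e ω - 2 * w e * W e ω) μ := (hint e).sub hi1
    -- Since `W² ≤ W` on `[0, 1]`, the variance is at most `w - w² ≤ p`.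
    have h1 : ∫ ω, (W e ω - w e) ^ 2 ∂μ ≤ ∫ ω, (W e ω - 2 * w e * W e ω + w e ^ 2) ∂μ := by
      refine integral_mono (hsq e) (hi2.add (integrable_const _)) fun ω => ?_
      have := h01 e ω
      simp only
      nlinarith [this.1, this.2]
    rw [integral_add hi2 (integrable_const _), integral_sub (hint e) hi1,
      integral_const_mul] at h1
    simp only [integral_const, probReal_univ, smul_eq_mul, one_mul] at h1
    change _ ≤ w e - 2 * w e * w e + w e ^ 2 at h1
    nlinarith [hp e, sq_nonneg (w e)]
  have hmain := measureReal_sum_ge_le (μ := μ) (X := fun e ω => c e * (W e ω - w e)) hmeas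
    (hindep.comp (fun e x => c e * (x - w e)) fun e => by fun_prop)
    (a := fun e => -|c e|) (b := fun e => |c e|) (fun e ω => abs_le.1 (habs e ω)) ht
    (v := fun e => t ^ 2 * p * c e ^ 2) (fun e => ?_) r
  · rwa [← Finset.mul_sum] at hmain
  -- This is `exp u ≤ 1 + u + u²` for `|u| ≤ 1`; the linear term integrates to zero.
  have hbd : ∀ ω, Real.exp (t * (c e * (W e ω - w e))) ≤
      1 + (t * c e) * (W e ω - w e) + (t * c e) ^ 2 * (W e ω - w e) ^ 2 := fun ω => by
    have h1 : |t * (c e * (W e ω - w e))| ≤ 1 := by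
      rw [abs_mul, abs_of_nonneg ht]
      exact (mul_le_mul_of_nonneg_left (habs e ω) ht).trans (hc e)
    have := (abs_le.1 (Real.abs_exp_sub_one_sub_id_le h1)).2
    nlinarith
  have hI1 : Integrable (fun ω => (t * c e) * (W e ω - w e)) μ :=
    ((hint e).sub (integrable_const _)).const_mul _
  have hI2 : Integrable (fun ω => (t * c e) ^ 2 * (W e ω - w e) ^ 2) μ := (hsq e).const_mul _
  have hI0 : Integrable (fun ω => 1 + (t * c e) * (W e ω - w e)) μ := (integrable_const _).add hI1
  calc ∫ ω, Real.exp (t * (c e * (W e ω - w e))) ∂μ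
      ≤ ∫ ω, (1 + (t * c e) * (W e ω - w e) + (t * c e) ^ 2 * (W e ω - w e) ^ 2) ∂μ :=
        integral_mono (integrable_exp_mul_of_mem_Icc (hmeas e) ht fun ω => abs_le.1 (habs e ω))
          (hI0.add hI2) hbd
    _ = 1 + (t * c e) ^ 2 * ∫ ω, (W e ω - w e) ^ 2 ∂μ := by
        rw [integral_add hI0 hI2, integral_add (integrable_const _) hI1, integral_const_mul,
          integral_const_mul, integral_sub (hint e) (integrable_const _)]
        simp [hw]
    _ ≤ 1 + (t * c e) ^ 2 * p := by gcongr; exact hvar e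
    _ ≤ Real.exp (t ^ 2 * p * c e ^ 2) := by
        have := Real.add_one_le_exp (t ^ 2 * p * c e ^ 2)
        nlinarith

/-- Chernoff's bound for weighted sums of independent `[0, 1]`-valued random variables of mean at
most `p`, with weights in `[0, 1]`. -/
theorem measureReal_weighted_sum_ge_le [Fintype ι] (hW : ∀ e, Measurable (W e))
    (hindep : iIndepFun W μ) (h01 : ∀ e ω, W e ω ∈ Set.Icc (0 : ℝ) 1)
    (hp : ∀ e, ∫ ω, W e ω ∂μ ≤ p) {c : ι → ℝ} (hc : ∀ e, c e ∈ Set.Icc (0 : ℝ) 1) {m : ℝ}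
    (hm : p * ∑ e, c e ≤ m) {t : ℝ} (ht : 0 ≤ t) (r : ℝ) :
    μ.real {ω | r ≤ ∑ e, c e * W e ω} ≤ Real.exp (m * (Real.exp t - 1) - t * r) := by
  have h01' : ∀ e ω, c e * W e ω ∈ Set.Icc (0 : ℝ) 1 := fun e ω =>
    ⟨mul_nonneg (hc e).1 (h01 e ω).1, mul_le_one₀ (hc e).2 (h01 e ω).1 (h01 e ω).2⟩
  have hmeas : ∀ e, Measurable fun ω => c e * W e ω := fun e => (hW e).const_mul _
  have ht' : 0 ≤ Real.exp t - 1 := by linarith [Real.add_one_le_exp t]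
  refine (measureReal_sum_ge_le (μ := μ) (X := fun e ω => c e * W e ω) hmeas
    (hindep.comp (fun e x => c e * x) fun e => by fun_prop)
    (a := fun e => 0) (b := fun e => 1) h01' ht
    (v := fun e => p * c e * (Real.exp t - 1)) (fun e => ?_) r).trans ?_
  · have hint : Integrable (fun ω => c e * W e ω * (Real.exp t - 1)) μ :=
      ((integrable_of_mem_Icc (hW e) (h01 e)).const_mul _).mul_const _
    calc ∫ ω, Real.exp (t * (c e * W e ω)) ∂μ
        ≤ ∫ ω, (1 + c e * W e ω * (Real.exp t - 1)) ∂μ :=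
          integral_mono (integrable_exp_mul_of_mem_Icc (hmeas e) ht (h01' e))
            ((integrable_const _).add hint) fun ω => exp_mul_le_of_mem_Icc (h01' e ω) t
      _ = 1 + c e * (∫ ω, W e ω ∂μ) * (Real.exp t - 1) := by
          rw [integral_add (integrable_const _) hint, integral_mul_const, integral_const_mul]
          simp
      _ ≤ 1 + c e * p * (Real.exp t - 1) := by
          gcongr
          · exact (hc e).1
          · exact hp e
      _ ≤ Real.exp (p * c e * (Real.exp t - 1)) := by
          have := Real.add_one_le_exp (p * c e * (Real.exp t - 1))
          linarith
  · rw [← Finset.sum_mul, ← Finset.mul_sum]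
    gcongr

/-- A form of Chernoff's bound that holds simultaneously for all values of the parameter. -/
theorem measureReal_exists_lt_mul_le {X : Ω → ℝ} {m h : ℝ} (hm : 0 ≤ m) (hh : 0 ≤ h)
    (hX : ∀ t, 0 ≤ t → ∀ r, μ.real {ω | r ≤ X ω} ≤ Real.exp (m * (Real.exp t - 1) - t * r)) :
    μ.real {ω | ∃ t, 0 < t ∧ m * Real.exp t + h < t * X ω} ≤ Real.exp (-h) := by
  -- If some `t` violates the bound then `X` exceeds the infimum of `(m e^t + h) / t`, so the
  -- uncountable union over `t` lies in a single tail event. That event is exhausted by the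
  -- increasing sets `s k`, each bounded through a near-optimal `t`.
  let G : Set ℝ := (fun t => (m * Real.exp t + h) / t) '' Set.Ioi 0
  have hG : BddBelow G := ⟨0, by
    rintro _ ⟨t, ht, rfl⟩
    have : (0 : ℝ) < t := ht
    positivity⟩
  have hGne : G.Nonempty := ⟨_, 1, Set.mem_Ioi.2 one_pos, rfl⟩
  set s : ℕ → Set Ω := fun k => {ω | sInf G + 1 / ((k : ℝ) + 1) ≤ X ω} with hs
  have hmono : Monotone s := fun a b hab ω hω => by
    have : 1 / ((b : ℝ) + 1) ≤ 1 / ((a : ℝ) + 1) := by gcongr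
    simp only [hs, Set.mem_ofPred_eq] at hω ⊢
    linarith
  have hsub : {ω | ∃ t, 0 < t ∧ m * Real.exp t + h < t * X ω} ⊆ ⋃ k, s k := by
    rintro ω ⟨t, ht, hlt⟩
    have h1 : sInf G < X ω := (csInf_le hG ⟨t, ht, rfl⟩).trans_lt (by
      rw [div_lt_iff₀ ht]; linarith)
    obtain ⟨k, hk⟩ := exists_nat_one_div_lt (sub_pos.2 h1)
    refine Set.mem_iUnion.2 ⟨k, ?_⟩
    simp only [hs, Set.mem_ofPred_eq]
    linarith
  have hbound : ∀ k, μ (s k) ≤ ENNReal.ofReal (Real.exp (-h)) := fun k => by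
    have hpos : (0 : ℝ) < 1 / ((k : ℝ) + 1) := by positivity
    obtain ⟨_, ⟨t, ht, rfl⟩, hlt⟩ := exists_lt_of_csInf_lt hGne (lt_add_of_pos_right (sInf G) hpos)
    have ht' : (0 : ℝ) < t := ht
    rw [← ofReal_measureReal]
    refine ENNReal.ofReal_le_ofReal ((hX t ht'.le _).trans (Real.exp_le_exp.2 ?_))
    simp only [div_lt_iff₀ ht'] at hlt
    linarith
  refine ENNReal.toReal_le_of_le_ofReal (Real.exp_pos _).le ((measure_mono hsub).trans ?_)
  rw [hmono.measure_iUnion]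
  exact iSup_le hbound

end Tail

/-! ### Deterministic bound for heavy pairs, from bounded degrees and discrepancy -/

section HeavyPairs

/-- A two-sided geometric series. It is dominated by a telescoping sum: for `φ z = -6 / (1 + z)` one
has `φ (2z) - φ z ≥ min z z⁻¹`, and `φ` varies by at most 6. -/
theorem sum_min_two_pow_le {c : ℝ} (hc : 0 < c) (L : ℕ) :
    ∑ a ∈ Finset.range L, min (c * 2 ^ a) (c * 2 ^ a)⁻¹ ≤ 6 := by
  have h : ∀ a ∈ Finset.range L, min (c * 2 ^ a) (c * 2 ^ a)⁻¹ ≤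
      6 * (-(1 + c * 2 ^ (a + 1))⁻¹) - 6 * (-(1 + c * 2 ^ a)⁻¹) := by
    intro a _
    have hz : 0 < c * 2 ^ a := by positivity
    rw [show c * 2 ^ (a + 1) = 2 * (c * 2 ^ a) by ring]
    generalize c * 2 ^ a = z at hz
    have h1 : 6 * (-(1 + 2 * z)⁻¹) - 6 * (-(1 + z)⁻¹) = 6 * z / ((1 + 2 * z) * (1 + z)) := by
      field_simp; ring
    rw [h1, le_div_iff₀ (by positivity)]
    rcases le_total z 1 with hz1 | hz1
    · refine (mul_le_mul_of_nonneg_right (min_le_left _ _) (by positivity)).trans ?_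
      nlinarith [mul_pos hz hz]
    · refine (mul_le_mul_of_nonneg_right (min_le_right _ _) (by positivity)).trans ?_
      rw [inv_mul_le_iff₀ hz]
      nlinarith
  refine (Finset.sum_le_sum h).trans ?_
  rw [Finset.sum_range_sub (fun a => 6 * (-(1 + c * 2 ^ a)⁻¹))]
  have h1 : 0 < (1 + c * 2 ^ L)⁻¹ := by positivity
  have h2 : (1 + c * 2 ^ 0)⁻¹ ≤ 1 := inv_le_one_of_one_le₀ (by simp [hc.le])
  linarith

theorem mul_one_add_log_le {α s θ τ : ℝ} (hα : 0 < α) (hα1 : α ≤ 1) (hs : 0 < s) (hτ : 1 ≤ τ)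
    (hθ : Real.log θ ≤ τ) (hαs : Real.log (α / s) ≤ τ) :
    α * (1 + Real.log θ - 2 * Real.log α - Real.log s) ≤ 6 * τ := by
  have h1 : -(α * Real.log α) ≤ 1 := by
    have := Real.one_sub_inv_le_log_of_pos hα
    have h2 : α * (1 - α⁻¹) ≤ α * Real.log α := mul_le_mul_of_nonneg_left this hα.le
    rw [mul_sub, mul_inv_cancel₀ hα.ne'] at h2
    linarith
  have h2 : α * Real.log θ ≤ τ := by nlinarith
  have h3 : -(α * Real.log s) ≤ 2 * τ := by
    rw [Real.log_div hα.ne' hs.ne'] at hαs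
    -- Either `-log s ≤ -2 log α`, and `-α log α ≤ 1` applies, or `log α ≥ (log s) / 2`, whence
    -- `-log s ≤ 2 log (α / s) ≤ 2τ`.
    rcases le_total (2 * Real.log α) (Real.log s) with h | h
    · nlinarith
    · nlinarith
  nlinarith

/-- When `Y / (r X) = α² > 1` the degree bound alone suffices: it leaves `α⁻²`, of which only `α⁻¹`
is needed for summability over levels. -/
theorem mul_le_of_one_lt_ratio {r X Y l E B α : ℝ} (hr : 0 < r) (hX : 0 < X) (hY : 0 < Y)
    (hl : 0 < l) (hB : 0 ≤ B) (hcol : E ≤ B * r ^ 2 * l) (hα : 1 < α) (hαY : Y = α ^ 2 * r * X) :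
    X * Y * E ≤ B * (r * (l * Y ^ 2 * α⁻¹)) := by
  have hα0 : 0 < α := by linarith
  calc X * Y * E ≤ X * Y * (B * r ^ 2 * l) := by gcongr
    _ = B * (r * (l * Y ^ 2 * (α⁻¹ * α⁻¹))) := by rw [hαY]; field_simp
    _ ≤ B * (r * (l * Y ^ 2 * (α⁻¹ * 1))) := by
      gcongr
      exact inv_le_one_of_one_le₀ hα.le
    _ = _ := by rw [mul_one]

/-- With `θ = XYn/r` and `s = kX²`, one has `n/k = θ / (α² s)` and `XYk = r α² s`, which reduces the
entropy term to `mul_one_add_log_le`. -/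
theorem mul_entropy_le {r n X Y k α τ : ℝ} (hr : 0 < r) (hn : 0 < n) (hX : 0 < X) (hY : 0 < Y)
    (hk : 0 < k) (hα : 0 < α) (hα1 : α ≤ 1) (hαY : Y = α ^ 2 * r * X) (hτ : 1 ≤ τ)
    (hθ : Real.log (X * Y * n / r) ≤ τ) (hαs : Real.log (α / (k * X ^ 2)) ≤ τ) :
    X * Y * (k * (1 + Real.log (n / k))) ≤ r * (6 * τ * (k * X ^ 2 * α)) := by
  have hs0 : 0 < k * X ^ 2 := by positivity
  have h1 : n / k = (X * Y * n / r) / (α ^ 2 * (k * X ^ 2)) := by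
    rw [hαY]; field_simp
  have h2 : X * Y * k = r * (α ^ 2 * (k * X ^ 2)) := by rw [hαY]; ring
  have h3 := mul_one_add_log_le hα hα1 hs0 hτ hθ hαs
  rw [h1, Real.log_div (by positivity) (by positivity), Real.log_mul (by positivity) hs0.ne',
    Real.log_pow]
  generalize Real.log (X * Y * n / r) = T at h3 ⊢
  generalize k * X ^ 2 = s at *
  calc X * Y * (k * (1 + (T - ((2 : ℕ) * Real.log α + Real.log s))))
      = X * Y * k * (1 + T - 2 * Real.log α - Real.log s) := by push_cast; ring
    _ = r * (α * (1 + T - 2 * Real.log α - Real.log s) * (s * α)) := by rw [h2]; ring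
    _ ≤ r * (6 * τ * (s * α)) := by gcongr

/-- The contribution of a pair of level sets, of sizes `k` and `l`, on which the coordinates of the
two vectors are about `X` and `Y`, when neither of `X` and `Y` is much larger than the other. -/
theorem level_pair_le_of_le_one {r n X Y k l E K α β : ℝ} (hr : 0 < r) (hn : 0 < n) (hX : 0 < X)
    (hY : 0 < Y) (hk : 0 < k) (hl : 0 < l) (hK : 0 ≤ K)
    (hdisc : ∀ τ, 0 < τ → τ * E ≤ r ^ 2 / n * k * l * Real.exp τ +
      K * (k * (1 + Real.log (n / k)) + l * (1 + Real.log (n / l))))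
    (hθ : 3 ≤ X * Y * n / r)
    (hα : 0 < α) (hα1 : α ≤ 1) (hαY : Y = α ^ 2 * r * X)
    (hβ : 0 < β) (hβ1 : β ≤ 1) (hβX : X = β ^ 2 * r * Y) :
    X * Y * E ≤ (1 + 6 * K) * (r * (k * X ^ 2 * (l * Y ^ 2) +
      (k * X ^ 2 + l * Y ^ 2) * (α + β))) := by
  have hs0 : 0 < k * X ^ 2 := by positivity
  have ht0 : 0 < l * Y ^ 2 := by positivity
  have hθ0 : 0 < X * Y * n / r := by linarith
  have hαs : 0 < α / (k * X ^ 2) := by positivity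
  have hβt : 0 < β / (l * Y ^ 2) := by positivity
  -- This `τ` turns the exponential term of the discrepancy bound exactly into an admissible
  -- contribution, while dominating the logarithms in the entropy terms. It is at least 1 because `θ
  -- ≥ 3 > e`.
  obtain ⟨τ, hτ⟩ : ∃ τ, τ = Real.log (X * Y * n / r * (1 + α / (k * X ^ 2) + β / (l * Y ^ 2))) :=
    ⟨_, rfl⟩
  have hexp : Real.exp τ = X * Y * n / r * (1 + α / (k * X ^ 2) + β / (l * Y ^ 2)) := by
    rw [hτ, Real.exp_log (by positivity)]
  have hτθ : Real.log (X * Y * n / r) ≤ τ := by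
    rw [hτ]
    exact Real.log_le_log hθ0 (le_mul_of_one_le_right hθ0.le (by linarith))
  have h1θ : ∀ z, 0 ≤ z → z ≤ X * Y * n / r * z := fun z hz =>
    le_mul_of_one_le_left hz (by linarith)
  have hτα : Real.log (α / (k * X ^ 2)) ≤ τ := by
    rw [hτ]
    exact Real.log_le_log hαs (le_trans (by linarith) (h1θ _ (by positivity)))
  have hτβ : Real.log (β / (l * Y ^ 2)) ≤ τ := by
    rw [hτ]
    exact Real.log_le_log hβt (le_trans (by linarith) (h1θ _ (by positivity)))
  have hτ1 : 1 ≤ τ := by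
    refine le_trans ?_ hτθ
    rw [Real.le_log_iff_exp_le hθ0]
    linarith [Real.exp_one_lt_three]
  have hE1 := mul_entropy_le hr hn hX hY hk hα hα1 hαY hτ1 hτθ hτα
  have hE2 := mul_entropy_le hr hn hY hX hl hβ hβ1 hβX hτ1 (by rwa [mul_comm Y X]) hτβ
  have hE0 : X * Y * (r ^ 2 / n * k * l * Real.exp τ) =
      r * (k * X ^ 2 * (l * Y ^ 2) + α * (l * Y ^ 2) + β * (k * X ^ 2)) := by
    rw [hexp]
    field_simp
  have hd := mul_le_mul_of_nonneg_left (hdisc τ (by linarith)) (mul_pos hX hY).le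
  rw [mul_add, hE0] at hd
  rw [mul_comm Y X] at hE2
  clear hdisc hE0 hexp hτθ hτα hτβ hθ h1θ hαs hβt hτ
  generalize k * X ^ 2 = s at *
  generalize l * Y ^ 2 = t at *
  have h1 : s * t + α * t + β * s ≤ s * t + (s + t) * (α + β) := by
    nlinarith [mul_pos hs0 hα, mul_pos ht0 hβ]
  have h2 : s * α + t * β ≤ s * t + (s + t) * (α + β) := by
    nlinarith [mul_pos hs0 hβ, mul_pos ht0 hα, mul_pos hs0 ht0]
  have hR0 : 0 ≤ s * t + (s + t) * (α + β) := by positivity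
  generalize s * t + (s + t) * (α + β) = R at *
  -- The entropy terms carry a factor `τ` and the exponential term is harmlessly multiplied by `τ ≥
  -- 1`, so `τ` cancels.
  have hmain : τ * (X * Y * E) ≤ τ * ((1 + 6 * K) * (r * R)) := by
    calc τ * (X * Y * E) = X * Y * (τ * E) := by ring
      _ ≤ r * (s * t + α * t + β * s) +
          K * (X * Y * (k * (1 + Real.log (n / k))) + X * Y * (l * (1 + Real.log (n / l)))) :=
        hd.trans (le_of_eq (by ring))
      _ ≤ r * R + K * (r * (6 * τ * (s * α)) + r * (6 * τ * (t * β))) := by gcongr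
      _ = 1 * (r * R) + K * (6 * τ * r) * (s * α + t * β) := by ring
      _ ≤ τ * (r * R) + K * (6 * τ * r) * R := by gcongr
      _ = τ * ((1 + 6 * K) * (r * R)) := by ring
  exact le_of_mul_le_mul_left hmain (by linarith)

/-- The contribution of a pair of level sets, of sizes `k` and `l`, on which the coordinates of the
two vectors are about `X` and `Y`. -/
theorem level_pair_le {r n X Y k l E K B α β : ℝ} (hr : 0 < r) (hn : 0 < n) (hX : 0 < X)
    (hY : 0 < Y) (hk : 0 < k) (hl : 0 < l) (hK : 0 ≤ K) (hB : 0 ≤ B)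
    (hdisc : ∀ τ, 0 < τ → τ * E ≤ r ^ 2 / n * k * l * Real.exp τ +
      K * (k * (1 + Real.log (n / k)) + l * (1 + Real.log (n / l))))
    (hrow : E ≤ B * r ^ 2 * k) (hcol : E ≤ B * r ^ 2 * l) (hθ : 3 ≤ X * Y * n / r)
    (hα : 0 < α) (hαY : Y = α ^ 2 * r * X) (hβ : 0 < β) (hβX : X = β ^ 2 * r * Y) :
    X * Y * E ≤ (1 + 6 * K + B) * (r * (k * X ^ 2 * (l * Y ^ 2) +
      (k * X ^ 2 + l * Y ^ 2) * (min α α⁻¹ + min β β⁻¹))) := by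
  have hs0 : 0 < k * X ^ 2 := by positivity
  have ht0 : 0 < l * Y ^ 2 := by positivity
  have hmα : 0 < min α α⁻¹ := lt_min hα (inv_pos.2 hα)
  have hmβ : 0 < min β β⁻¹ := lt_min hβ (inv_pos.2 hβ)
  have hA := fun h : 1 < α => mul_le_of_one_lt_ratio hr hX hY hl hB hcol h hαY
  have hB' := fun h : 1 < β => mul_le_of_one_lt_ratio hr hY hX hk hB hrow h hβX
  have hC := fun (h : α ≤ 1) (h' : β ≤ 1) =>
    level_pair_le_of_le_one hr hn hX hY hk hl hK hdisc hθ hα h hαY hβ h' hβX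
  rw [mul_comm Y X] at hB'
  clear hdisc hrow hcol hθ hαY hβX
  generalize X * Y * E = Z at *
  generalize k * X ^ 2 = s at *
  generalize l * Y ^ 2 = t at *
  have hle : ∀ z c, 0 ≤ c → c ≤ 1 + 6 * K + B → z ≤ s * t + (s + t) * (min α α⁻¹ + min β β⁻¹) →
      c * (r * z) ≤ (1 + 6 * K + B) * (r * (s * t + (s + t) * (min α α⁻¹ + min β β⁻¹))) := by
    intro z c hc hcK hz
    calc c * (r * z) ≤ c * (r * (s * t + (s + t) * (min α α⁻¹ + min β β⁻¹))) := by gcongr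
      _ ≤ _ := by gcongr
  -- `min α α⁻¹` is `α⁻¹` where the degree bound is used and `α` where the discrepancy bound is
  -- used.
  rcases lt_or_ge 1 α with hα1 | hα1
  · refine (hA hα1).trans (hle _ _ hB (by linarith) ?_)
    rw [min_eq_right ((inv_le_one_of_one_le₀ hα1.le).trans hα1.le)] at hmα ⊢
    nlinarith [mul_pos hs0 ht0, mul_pos hs0 hmα, mul_pos hs0 hmβ, mul_pos ht0 hmβ]
  rcases lt_or_ge 1 β with hβ1 | hβ1
  · refine (hB' hβ1).trans (hle _ _ hB (by linarith) ?_)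
    rw [min_eq_right ((inv_le_one_of_one_le₀ hβ1.le).trans hβ1.le)] at hmβ ⊢
    nlinarith [mul_pos hs0 ht0, mul_pos hs0 hmα, mul_pos ht0 hmα, mul_pos ht0 hmβ]
  · refine (hC hα1 hβ1).trans (hle _ _ (by positivity) (by linarith) (le_of_eq ?_))
    rw [min_eq_left (hα1.trans ((one_le_inv₀ hα).2 hα1)),
      min_eq_left (hβ1.trans ((one_le_inv₀ hβ).2 hβ1))]

/-- Levels are powers of `1/4` so that square roots of their ratios are powers of 2, as
`sum_min_two_pow_le` requires. A zero coordinate has no level, hence the guard. -/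
theorem exists_level {x : ℝ} (hx : |x| ≤ 1) :
    ∃ a : ℕ, x ≠ 0 → |x| ≤ (1 / 4 : ℝ) ^ a ∧ ((1 / 4 : ℝ) ^ a) ^ 2 ≤ 16 * x ^ 2 := by
  by_cases h0 : x = 0
  · exact ⟨0, fun h => absurd h0 h⟩
  obtain ⟨a, h1, h2⟩ := exists_nat_pow_near_of_lt_one (abs_pos.2 h0) hx
    (show (0 : ℝ) < 1 / 4 by norm_num) (by norm_num)
  refine ⟨a, fun _ => ⟨h2, ?_⟩⟩
  rw [pow_succ] at h1
  have h3 : (1 / 4 : ℝ) ^ a ≤ 4 * |x| := by linarith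
  have h4 : (0 : ℝ) < (1 / 4) ^ a := by positivity
  calc ((1 / 4 : ℝ) ^ a) ^ 2 ≤ (4 * |x|) ^ 2 := by gcongr
    _ = 16 * x ^ 2 := by rw [mul_pow, sq_abs]; norm_num

/-- A nonnegative matrix with bounded row and column sums and without too dense submatrices has a
small contribution to the bilinear form from the pairs of large coordinates. -/
theorem sum_heavy_le {n : ℕ} {M : Fin n → Fin n → ℝ} {D K B : ℝ} (hD : 0 < D) (hK : 0 ≤ K)
    (hB : 0 ≤ B) (hM : ∀ i j, 0 ≤ M i j) (hrow : ∀ i, ∑ j, M i j ≤ B * D)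
    (hcol : ∀ j, ∑ i, M i j ≤ B * D)
    (hdisc : ∀ S T : Finset (Fin n), S.Nonempty → T.Nonempty → ∀ τ, 0 < τ →
      τ * ∑ i ∈ S, ∑ j ∈ T, M i j ≤ D / n * S.card * T.card * Real.exp τ +
        K * (S.card * (1 + Real.log (n / S.card)) + T.card * (1 + Real.log (n / T.card))))
    {x y : Fin n → ℝ} (hx : ∑ i, x i ^ 2 ≤ 1) (hy : ∑ i, y i ^ 2 ≤ 1) :
    ∑ i, ∑ j, (if 3 * √D / n < |x i| * |y j| then M i j * (|x i| * |y j|) else 0) ≤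
      640 * (1 + 6 * K + B) * √D := by
  classical
  rcases Nat.eq_zero_or_pos n with rfl | hn
  · simp only [Finset.univ_eq_empty, Finset.sum_empty]
    positivity
  have hnR : (0 : ℝ) < n := by exact_mod_cast hn
  have hr : 0 < √D := Real.sqrt_pos.2 hD
  have habs : ∀ z : Fin n → ℝ, ∑ i, z i ^ 2 ≤ 1 → ∀ i, |z i| ≤ 1 := fun z hz i => by
    rw [← sq_le_one_iff_abs_le_one]
    exact (Finset.single_le_sum (fun j _ => sq_nonneg (z j)) (Finset.mem_univ i)).trans hz
  choose f hf using fun i => exists_level (habs x hx i)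
  choose g hg using fun i => exists_level (habs y hy i)
  obtain ⟨L, hLf, hLg⟩ : ∃ L, (∀ i, f i < L) ∧ ∀ i, g i < L := by
    refine ⟨(∑ i, f i) + (∑ i, g i) + 1, fun i => ?_, fun i => ?_⟩
    · have := Finset.single_le_sum (fun j _ => Nat.zero_le (f j)) (Finset.mem_univ i)
      omega
    · have := Finset.single_le_sum (fun j _ => Nat.zero_le (g j)) (Finset.mem_univ i)
      omega
  set X : ℕ → ℝ := fun a => (1 / 4 : ℝ) ^ a with hX
  have hX0 : ∀ a, 0 < X a := fun a => by positivity
  let S : ℕ → Finset (Fin n) := fun a => (Finset.univ.filter fun i => x i ≠ 0).filter (f · = a)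
  let T : ℕ → Finset (Fin n) := fun b => (Finset.univ.filter fun j => y j ≠ 0).filter (g · = b)
  set s : ℕ → ℝ := fun a => (S a).card * X a ^ 2 with hs
  set t : ℕ → ℝ := fun b => (T b).card * X b ^ 2 with ht
  have hs0 : ∀ a, 0 ≤ s a := fun a => by positivity
  have ht0 : ∀ a, 0 ≤ t a := fun a => by positivity
  -- Replacing each coordinate by its level inflates the squared norm by at most 16.
  have hlevel : ∀ (z : Fin n → ℝ) (h : Fin n → ℕ), ∑ i, z i ^ 2 ≤ 1 → (∀ i, h i < L) →
      (∀ i, z i ≠ 0 → |z i| ≤ X (h i) ∧ X (h i) ^ 2 ≤ 16 * z i ^ 2) →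
      ∑ a ∈ Finset.range L, ((Finset.univ.filter fun i => z i ≠ 0).filter (h · = a)).card *
        X a ^ 2 ≤ 16 := by
    intro z h hz hL hh
    calc ∑ a ∈ Finset.range L, ((Finset.univ.filter fun i => z i ≠ 0).filter (h · = a)).card *
          X a ^ 2
        ≤ ∑ a ∈ Finset.range L, ∑ i ∈ (Finset.univ.filter fun i => z i ≠ 0).filter (h · = a),
            16 * z i ^ 2 := by
          refine Finset.sum_le_sum fun a _ => ?_
          rw [← nsmul_eq_mul]
          refine Finset.card_nsmul_le_sum _ _ _ fun i hi => ?_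
          simp only [Finset.mem_filter, Finset.mem_univ, true_and] at hi
          rw [← hi.2]
          exact (hh i hi.1).2
      _ = ∑ i ∈ Finset.univ.filter (fun i => z i ≠ 0), 16 * z i ^ 2 :=
          Finset.sum_fiberwise_of_maps_to (fun i _ => Finset.mem_range.2 (hL i)) _
      _ ≤ ∑ i, 16 * z i ^ 2 :=
          Finset.sum_le_sum_of_subset_of_nonneg (Finset.subset_univ _) fun _ _ _ => by positivity
      _ ≤ 16 := by rw [← Finset.mul_sum]; linarith
  have hssum : ∑ a ∈ Finset.range L, s a ≤ 16 := hlevel x f hx hLf hf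
  have htsum : ∑ b ∈ Finset.range L, t b ≤ 16 := hlevel y g hy hLg hg
  let E : ℕ → ℕ → ℝ := fun a b => ∑ i ∈ S a, ∑ j ∈ T b, M i j
  have hE0 : ∀ a b, 0 ≤ E a b := fun a b =>
    Finset.sum_nonneg fun i _ => Finset.sum_nonneg fun j _ => hM i j
  let F : ℕ → ℕ → ℝ := fun a b => if 3 ≤ X a * X b * n / √D then X a * X b else 0
  have hF0 : ∀ a b, 0 ≤ F a b := fun a b => by
    simp only [F]; split_ifs <;> positivity
  have hstep : ∑ i, ∑ j, (if 3 * √D / n < |x i| * |y j| then M i j * (|x i| * |y j|) else 0) ≤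
      ∑ a ∈ Finset.range L, ∑ b ∈ Finset.range L, F a b * E a b := by
    have hterm : ∀ i j,
        (if 3 * √D / n < |x i| * |y j| then M i j * (|x i| * |y j|) else 0) ≤
        if x i ≠ 0 then (if y j ≠ 0 then F (f i) (g j) * M i j else 0) else 0 := by
      intro i j
      by_cases hxi : x i = 0
      · simp only [hxi, abs_zero, zero_mul, mul_zero, ite_self, ne_eq, not_true_eq_false, if_false]
        exact le_rfl
      by_cases hyj : y j = 0
      · simp only [hyj, abs_zero, mul_zero, ite_self, ne_eq, not_true_eq_false, if_false]
        exact le_rfl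
      rw [if_pos hxi, if_pos hyj]
      split_ifs with hlt
      · have h1 : |x i| * |y j| ≤ X (f i) * X (g j) :=
          mul_le_mul (hf i hxi).1 (hg j hyj).1 (abs_nonneg _) (hX0 _).le
        have h2 : 3 ≤ X (f i) * X (g j) * n / √D := by
          rw [div_lt_iff₀ hnR] at hlt
          rw [le_div_iff₀ hr]
          nlinarith
        simp only [F, if_pos h2]
        rw [mul_comm]
        exact mul_le_mul_of_nonneg_right h1 (hM i j)
      · exact mul_nonneg (hF0 _ _) (hM i j)
    refine (Finset.sum_le_sum fun i _ => Finset.sum_le_sum fun j _ => hterm i j).trans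
      (le_of_eq ?_)
    have hin : ∀ i, ∑ j, (if x i ≠ 0 then (if y j ≠ 0 then F (f i) (g j) * M i j else 0) else 0) =
        if x i ≠ 0 then ∑ b ∈ Finset.range L, ∑ j ∈ T b, F (f i) b * M i j else 0 := by
      intro i
      split_ifs with hxi
      · rw [← Finset.sum_filter,
          ← Finset.sum_fiberwise_of_maps_to (g := g) (t := Finset.range L)
            (fun j _ => Finset.mem_range.2 (hLg j))]
        refine Finset.sum_congr rfl fun b _ => Finset.sum_congr rfl fun j hj => ?_
        rw [(Finset.mem_filter.1 hj).2]
      · simp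
    rw [Finset.sum_congr rfl fun i _ => hin i, ← Finset.sum_filter,
      ← Finset.sum_fiberwise_of_maps_to (g := f) (t := Finset.range L)
        (fun j _ => Finset.mem_range.2 (hLf j))]
    refine Finset.sum_congr rfl fun a _ => ?_
    rw [Finset.sum_comm]
    refine Finset.sum_congr rfl fun b _ => ?_
    simp only [E]
    rw [Finset.mul_sum]
    refine Finset.sum_congr rfl fun i hi => ?_
    rw [Finset.mul_sum, (Finset.mem_filter.1 hi).2]
  -- `w a b` is `min α α⁻¹` with `α² = X b / (√D X a)`; swapping `a` and `b` gives the same quantity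
  -- for `β`. Its row and column sums are at most 6.
  set w : ℕ → ℕ → ℝ := fun a b => min ((√√D)⁻¹ * (1 / 2) ^ b * 2 ^ a)
    ((√√D)⁻¹ * (1 / 2) ^ b * 2 ^ a)⁻¹ with hw
  have hrr : 0 < √√D := Real.sqrt_pos.2 hr
  have hw0 : ∀ a b, 0 ≤ w a b := fun a b => by simp only [hw]; positivity
  have hwsum : ∀ b, ∑ a ∈ Finset.range L, w a b ≤ 6 := fun b =>
    sum_min_two_pow_le (by positivity) L
  have hwsum' : ∀ a, ∑ b ∈ Finset.range L, w a b ≤ 6 := fun a => by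
    refine le_trans (Finset.sum_le_sum fun b _ => le_of_eq ?_)
      (sum_min_two_pow_le (c := √√D * (1 / 2) ^ a) (by positivity) L)
    have : ((√√D)⁻¹ * (1 / 2) ^ b * 2 ^ a)⁻¹ = √√D * (1 / 2) ^ a * 2 ^ b := by
      simp only [one_div, inv_pow, mul_inv, inv_inv]; ring
    simp only [hw]
    rw [← this, inv_inv, min_comm]
  have hpair : ∀ a b, F a b * E a b ≤
      (1 + 6 * K + B) * (√D * (s a * t b + (s a + t b) * (w a b + w b a))) := by
    intro a b
    have hR0 : 0 ≤ (1 + 6 * K + B) * (√D * (s a * t b + (s a + t b) * (w a b + w b a))) := by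
      have := hs0 a
      have := ht0 b
      have := hw0 a b
      have := hw0 b a
      positivity
    rcases (S a).eq_empty_or_nonempty with hSa | hSa
    · have : E a b = 0 := by simp only [E, hSa, Finset.sum_empty]
      rw [this, mul_zero]
      exact hR0
    rcases (T b).eq_empty_or_nonempty with hTb | hTb
    · have : E a b = 0 := by simp only [E, hTb, Finset.sum_empty, Finset.sum_const_zero]
      rw [this, mul_zero]
      exact hR0
    by_cases hθ : 3 ≤ X a * X b * n / √D
    · simp only [F, if_pos hθ]
      have hrα : ∀ a b : ℕ, X b = ((√√D)⁻¹ * (1 / 2) ^ b * 2 ^ a) ^ 2 * √D * X a := fun a b => by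
        simp only [hX]
        have h4 : ((2 : ℝ) ^ a) ^ 2 * (1 / 4) ^ a = 1 := by
          rw [← pow_mul, mul_comm a 2, pow_mul, ← mul_pow]; norm_num
        have h2 : ((1 / 2 : ℝ) ^ b) ^ 2 = (1 / 4) ^ b := by
          rw [← pow_mul, mul_comm b 2, pow_mul]; norm_num
        calc (1 / 4 : ℝ) ^ b = ((√D)⁻¹ * √D) * ((1 / 2) ^ b) ^ 2 * (((2 : ℝ) ^ a) ^ 2 * (1 / 4) ^ a)
            := by rw [h4, h2, inv_mul_cancel₀ hr.ne']; ring
          _ = ((√√D)⁻¹ * (1 / 2) ^ b * 2 ^ a) ^ 2 * √D * (1 / 4) ^ a := by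
            rw [mul_pow, mul_pow, inv_pow, Real.sq_sqrt hr.le]; ring
      have hDsq : √D ^ 2 = D := Real.sq_sqrt hD.le
      refine level_pair_le hr hnR (hX0 a) (hX0 b) (Nat.cast_pos.2 hSa.card_pos)
        (Nat.cast_pos.2 hTb.card_pos) hK hB (fun τ hτ => ?_) ?_ ?_ hθ (by positivity)
        (hrα a b) (by positivity) (hrα b a)
      · rw [hDsq]
        exact hdisc _ _ hSa hTb τ hτ
      · rw [hDsq]
        calc E a b ≤ ∑ i ∈ S a, B * D := Finset.sum_le_sum fun i _ =>
              (Finset.sum_le_sum_of_subset_of_nonneg (Finset.subset_univ _)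
                fun j _ _ => hM i j).trans (hrow i)
          _ = B * D * (S a).card := by rw [Finset.sum_const, nsmul_eq_mul, mul_comm]
      · rw [hDsq]
        calc E a b = ∑ j ∈ T b, ∑ i ∈ S a, M i j := Finset.sum_comm
          _ ≤ ∑ j ∈ T b, B * D := Finset.sum_le_sum fun j _ =>
              (Finset.sum_le_sum_of_subset_of_nonneg (Finset.subset_univ _)
                fun i _ _ => hM i j).trans (hcol j)
          _ = B * D * (T b).card := by rw [Finset.sum_const, nsmul_eq_mul, mul_comm]
    · simp only [F, if_neg hθ, zero_mul]
      exact hR0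
  -- Here `640 = 16·16 + 16·12 + 16·12`, where `12 = 6 + 6` sums both weights.
  have hts : ∑ a ∈ Finset.range L, ∑ b ∈ Finset.range L,
      (s a * t b + (s a + t b) * (w a b + w b a)) ≤ 640 := by
    have h1 : ∑ a ∈ Finset.range L, ∑ b ∈ Finset.range L, s a * t b ≤ 256 := by
      rw [← Finset.sum_mul_sum]
      calc _ ≤ (16 : ℝ) * 16 :=
            mul_le_mul hssum htsum (Finset.sum_nonneg fun b _ => ht0 b) (by norm_num)
        _ = 256 := by norm_num
    have h2 : ∑ a ∈ Finset.range L, ∑ b ∈ Finset.range L, s a * (w a b + w b a) ≤ 192 := by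
      calc _ ≤ ∑ a ∈ Finset.range L, s a * 12 := by
            refine Finset.sum_le_sum fun a _ => ?_
            rw [← Finset.mul_sum, Finset.sum_add_distrib]
            refine mul_le_mul_of_nonneg_left ?_ (hs0 a)
            linarith [hwsum a, hwsum' a]
        _ ≤ 192 := by rw [← Finset.sum_mul]; linarith
    have h3 : ∑ a ∈ Finset.range L, ∑ b ∈ Finset.range L, t b * (w a b + w b a) ≤ 192 := by
      rw [Finset.sum_comm]
      calc _ ≤ ∑ b ∈ Finset.range L, t b * 12 := by
            refine Finset.sum_le_sum fun b _ => ?_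
            rw [← Finset.mul_sum, Finset.sum_add_distrib]
            refine mul_le_mul_of_nonneg_left ?_ (ht0 b)
            linarith [hwsum b, hwsum' b]
        _ ≤ 192 := by rw [← Finset.sum_mul]; linarith
    simp only [add_mul, Finset.sum_add_distrib] at h1 h2 h3 ⊢
    linarith
  calc _ ≤ ∑ a ∈ Finset.range L, ∑ b ∈ Finset.range L, F a b * E a b := hstep
    _ ≤ ∑ a ∈ Finset.range L, ∑ b ∈ Finset.range L,
        (1 + 6 * K + B) * (√D * (s a * t b + (s a + t b) * (w a b + w b a))) :=
      Finset.sum_le_sum fun a _ => Finset.sum_le_sum fun b _ => hpair a b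
    _ = (1 + 6 * K + B) * (√D * ∑ a ∈ Finset.range L, ∑ b ∈ Finset.range L,
        (s a * t b + (s a + t b) * (w a b + w b a))) := by
      simp only [Finset.mul_sum]
    _ ≤ (1 + 6 * K + B) * (√D * 640) := by gcongr
    _ = _ := by ring

end HeavyPairs

/-! ### Linear forms in the similarity matrix as sums over edges -/

section PairSums

variable {n d : ℕ}

/-- The sum of `f` over the ordered pairs of distinct vertices of an edge. -/
def pairSum (f : Fin n → Fin n → ℝ) (e : Edge n d) : ℝ :=
  ∑ x ∈ e.1 ×ˢ e.1, if x.1 ≠ x.2 then f x.1 x.2 else 0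

/-- Removing `i` and `j` is a bijection onto the `(d-2)`-subsets of the rest of `U`. A community as
`U` counts the homogeneous edges through the pair; the whole vertex set counts all of them. -/
theorem card_filter_pair_subset (hd : 2 ≤ d) (U : Finset (Fin n)) {i j : Fin n} (hij : i ≠ j)
    (hi : i ∈ U) (hj : j ∈ U) :
    (Finset.univ.filter fun e : Edge n d => (i ∈ e.1 ∧ j ∈ e.1) ∧ e.1 ⊆ U).card =
      (U.card - 2).choose (d - 2) := by
  classical
  have hU : (U \ {i, j}).card = U.card - 2 := by
    rw [Finset.card_sdiff_of_subset (by
      intro x hx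
      rcases Finset.mem_insert.1 hx with rfl | hx
      · exact hi
      · rwa [Finset.mem_singleton.1 hx]), Finset.card_pair hij]
  rw [← hU, ← Finset.card_powersetCard]
  refine Finset.card_bij (fun e _ => e.1 \ {i, j}) ?_ ?_ ?_
  · intro e he
    simp only [Finset.mem_filter, Finset.mem_univ, true_and] at he
    rw [Finset.mem_powersetCard]
    refine ⟨Finset.sdiff_subset_sdiff he.2 subset_rfl, ?_⟩
    rw [Finset.card_sdiff_of_subset (by
      intro x hx
      rcases Finset.mem_insert.1 hx with rfl | hx
      · exact he.1.1
      · rw [Finset.mem_singleton.1 hx]; exact he.1.2), Finset.card_pair hij, e.2]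
  · intro e he e' he' h
    simp only [Finset.mem_filter, Finset.mem_univ, true_and] at he he'
    apply Subtype.ext
    ext x
    by_cases hxi : x = i
    · simp [hxi, he.1.1, he'.1.1]
    by_cases hxj : x = j
    · simp [hxj, he.1.2, he'.1.2]
    · have := Finset.ext_iff.1 h x
      simpa [hxi, hxj] using this
  · intro t ht
    rw [Finset.mem_powersetCard] at ht
    have hit : i ∉ t := fun h => by have := ht.1 h; simp at this
    have hjt : j ∉ t := fun h => by have := ht.1 h; simp at this
    refine ⟨⟨insert i (insert j t), ?_⟩, ?_, ?_⟩
    · rw [Finset.card_insert_of_notMem (by simp [hij, hit]), Finset.card_insert_of_notMem hjt,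
        ht.2]
      omega
    · simp only [Finset.mem_filter, Finset.mem_univ, true_and]
      refine ⟨by simp, ?_⟩
      intro x hx
      rcases Finset.mem_insert.1 hx with rfl | hx
      · exact hi
      rcases Finset.mem_insert.1 hx with rfl | hx
      · exact hj
      · exact (Finset.mem_sdiff.1 (ht.1 hx)).1
    · ext x
      by_cases hxi : x = i
      · simp [hxi, hit]
      by_cases hxj : x = j
      · simp [hxj, hjt]
      · simp [hxi, hxj]

theorem card_filter_pair (hd : 2 ≤ d) {i j : Fin n} (hij : i ≠ j) :
    (Finset.univ.filter fun e : Edge n d => i ∈ e.1 ∧ j ∈ e.1).card =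
      (n - 2).choose (d - 2) := by
  have := card_filter_pair_subset (d := d) hd Finset.univ hij (Finset.mem_univ _)
    (Finset.mem_univ _)
  simpa using this

/-- Exchanging summations restores independence: the entries share edges, but the weights on the
right are independent. -/
theorem sum_mul_similarity (f : Fin n → Fin n → ℝ) (w : Edge n d → ℝ) :
    ∑ i, ∑ j, f i j * similarity w i j = ∑ e, pairSum f e * w e := by
  have h1 : ∀ i j, f i j * similarity w i j =
      ∑ e : Edge n d, if i ∈ e.1 ∧ j ∈ e.1 then (if i ≠ j then f i j else 0) * w e else 0 := by
    intro i j
    simp only [similarity, Matrix.of_apply]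
    by_cases hij : i = j
    · simp [hij]
    · rw [if_neg hij, Finset.mul_sum, Finset.sum_filter]
      simp [hij]
  have h2 : ∀ e : Edge n d, pairSum f e * w e =
      ∑ i, ∑ j, if i ∈ e.1 ∧ j ∈ e.1 then (if i ≠ j then f i j else 0) * w e else 0 := by
    intro e
    rw [pairSum, Finset.sum_mul, ← Finset.sum_product', Finset.univ_product_univ,
      ← Finset.sum_filter]
    exact Finset.sum_congr (by ext; simp) fun _ _ => rfl
  simp_rw [h1, h2]
  conv_lhs => enter [2, i]; rw [Finset.sum_comm]
  rw [Finset.sum_comm]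

theorem sum_pairSum_le (hd : 2 ≤ d) {f : Fin n → Fin n → ℝ} (hf : ∀ i j, 0 ≤ f i j) :
    ∑ e : Edge n d, pairSum f e ≤ ((n - 2).choose (d - 2) : ℝ) * ∑ i, ∑ j, f i j := by
  have h := sum_mul_similarity f (fun _ : Edge n d => 1)
  simp only [mul_one] at h
  rw [← h, Finset.mul_sum]
  refine Finset.sum_le_sum fun i _ => ?_
  rw [Finset.mul_sum]
  refine Finset.sum_le_sum fun j _ => ?_
  rw [mul_comm]
  refine mul_le_mul_of_nonneg_right ?_ (hf i j)
  simp only [similarity, Matrix.of_apply]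
  split_ifs with hij
  · positivity
  · rw [Finset.sum_const, card_filter_pair hd hij]
    simp

theorem abs_pairSum_le {f : Fin n → Fin n → ℝ} {b : ℝ} (hb : 0 ≤ b) (hf : ∀ i j, |f i j| ≤ b)
    (e : Edge n d) : |pairSum f e| ≤ (d : ℝ) ^ 2 * b := by
  refine (Finset.abs_sum_le_sum_abs _ _).trans ?_
  calc _ ≤ ∑ x ∈ e.1 ×ˢ e.1, b := Finset.sum_le_sum fun x _ => by
        split_ifs
        · exact hf _ _
        · simpa using hb
    _ = _ := by
      rw [Finset.sum_const, Finset.card_product, e.2, nsmul_eq_mul]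
      push_cast
      ring

theorem pairSum_nonneg {f : Fin n → Fin n → ℝ} (hf : ∀ i j, 0 ≤ f i j) (e : Edge n d) :
    0 ≤ pairSum f e :=
  Finset.sum_nonneg fun x _ => by split_ifs <;> simp [hf]

theorem pairSum_sq_le (f : Fin n → Fin n → ℝ) (e : Edge n d) :
    pairSum f e ^ 2 ≤ (d : ℝ) ^ 2 * pairSum (fun i j => f i j ^ 2) e := by
  refine sq_sum_le_card_mul_sum_sq.trans (le_of_eq ?_)
  rw [Finset.card_product, e.2, pairSum]
  push_cast
  rw [sq (d : ℝ)]
  congr 1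
  refine Finset.sum_congr rfl fun x _ => ?_
  split_ifs <;> simp

theorem similarity_nonneg {w : Edge n d → ℝ} (hw : ∀ e, 0 ≤ w e) (i j : Fin n) :
    0 ≤ similarity w i j := by
  simp only [similarity, Matrix.of_apply]
  split_ifs
  · exact le_rfl
  · exact Finset.sum_nonneg fun e _ => hw e

theorem similarity_symm (w : Edge n d → ℝ) (i j : Fin n) : similarity w i j = similarity w j i := by
  have := (similarity_isHermitian w).apply i j
  simpa using this.symm

theorem similarity_le (hd : 2 ≤ d) {w : Edge n d → ℝ} {p : ℝ} (hp : 0 ≤ p) (hw : ∀ e, w e ≤ p)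
    (i j : Fin n) : similarity w i j ≤ ((n - 2).choose (d - 2) : ℝ) * p := by
  simp only [similarity, Matrix.of_apply]
  split_ifs with hij
  · positivity
  · rw [← card_filter_pair hd hij, ← nsmul_eq_mul]
    exact Finset.sum_le_card_nsmul _ _ _ fun e _ => hw e

end PairSums

theorem IsSample.mean_le {Ω : Type*} [MeasurableSpace Ω] {μ : Measure Ω} {n d k : ℕ} {p q : ℝ}
    {Φ : Fin n → Fin k} {W : Edge n d → Ω → ℝ} (h : IsSample μ p q Φ W) (hqp : q ≤ p) (e : Edge n d) :
    ∫ ω, W e ω ∂μ ≤ p := by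
  by_cases he : Homogeneous Φ e
  · exact (h.mean_homogeneous e he).le
  · exact (h.mean_heterogeneous e he).trans_le hqp

section Model

variable {Ω : Type*} [MeasurableSpace Ω] {μ : Measure Ω} [IsProbabilityMeasure μ]
  {n d k : ℕ} {p q : ℝ} {Φ : Fin n → Fin k} {W : Edge n d → Ω → ℝ}

theorem IsSample.meanSimilarity_eq (h : IsSample μ p q Φ W) :
    meanSimilarity μ W = similarity fun e => ∫ ω, W e ω ∂μ := by
  ext i j
  simp only [meanSimilarity, similarity, Matrix.of_apply]
  split_ifs
  · simp
  · exact integral_finsetSum _ fun e _ => integrable_of_mem_Icc (h.measurable e) (h.mem_Icc e)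

end Model

/-! ### Binomial entropy estimates for union bounds over vertex sets -/

section Entropy

theorem log_le_entropy {n k : ℕ} (hk : 1 ≤ k) (hkn : k ≤ n) :
    Real.log n ≤ k * (1 + Real.log (n / k)) := by
  have hk0 : (0 : ℝ) < k := by exact_mod_cast hk
  have hn0 : (0 : ℝ) < n := by exact_mod_cast hk.trans hkn
  have hk1 : (1 : ℝ) ≤ k := by exact_mod_cast hk
  have h1 : 0 ≤ Real.log (n / k) :=
    Real.log_nonneg ((one_le_div hk0).2 (by exact_mod_cast hkn))
  have h2 : Real.log n = Real.log (n / k) + Real.log k := by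
    rw [Real.log_div hn0.ne' hk0.ne']; ring
  have h3 := Real.log_le_sub_one_of_pos hk0
  nlinarith

/-- This is `C(n,k) ≤ (en/k)^k`, from `k^k / k! ≤ e^k`. -/
theorem exp_neg_entropy_le {n k : ℕ} (hk : 1 ≤ k) (hkn : k ≤ n) :
    Real.exp (-(k * (1 + Real.log (n / k)))) ≤ ((n.choose k : ℕ) : ℝ)⁻¹ := by
  have hk0 : (0 : ℝ) < k := by exact_mod_cast hk
  have hn0 : (0 : ℝ) < n := by exact_mod_cast hk.trans hkn
  have hC : (0 : ℝ) < (n.choose k : ℕ) := by exact_mod_cast Nat.choose_pos hkn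
  rw [Real.exp_neg]
  refine inv_anti₀ hC ?_
  calc ((n.choose k : ℕ) : ℝ) ≤ (n : ℝ) ^ k / (k.factorial : ℝ) := Nat.choose_le_pow_div k n
    _ = (n / k : ℝ) ^ k * ((k : ℝ) ^ k / (k.factorial : ℝ)) := by
      rw [div_pow]; field_simp
    _ ≤ (n / k : ℝ) ^ k * Real.exp k := by
      gcongr
      exact Real.pow_div_factorial_le_exp _ hk0.le k
    _ = Real.exp (k * (1 + Real.log (n / k))) := by
      rw [mul_add, Real.exp_add, mul_one, mul_comm (Real.exp (k : ℝ)), ← Real.log_pow,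
        Real.exp_log (by positivity)]

theorem exp_neg_mul_log {n : ℕ} (hn : 0 < n) (m : ℕ) :
    Real.exp (-(m * Real.log n)) = ((n : ℝ) ^ m)⁻¹ := by
  rw [Real.exp_neg, ← Real.log_pow, Real.exp_log (by positivity)]

/-- One copy of the entropy pays for the choice of a `k`-set; the other eight each yield a factor
`n⁻¹`. -/
theorem exp_neg_nine_mul_entropy_le {n k : ℕ} (hk : 1 ≤ k) (hkn : k ≤ n) :
    Real.exp (-(9 * (k * (1 + Real.log (n / k))))) ≤
      ((n.choose k : ℕ) : ℝ)⁻¹ * ((n : ℝ) ^ 8)⁻¹ := by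
  have h1 := exp_neg_entropy_le hk hkn
  have h2 := log_le_entropy hk hkn
  rw [← exp_neg_mul_log (hk.trans hkn) 8]
  generalize (k * (1 + Real.log (n / k)) : ℝ) = H at *
  rw [show -(9 * H) = -H + -(8 * H) by ring, Real.exp_add]
  push_cast
  gcongr

theorem sum_inv_choose_card (n : ℕ) :
    ∑ S : Finset (Fin n), ((n.choose S.card : ℕ) : ℝ)⁻¹ = n + 1 := by
  have := Finset.sum_powerset_apply_card (fun k => ((n.choose k : ℕ) : ℝ)⁻¹)
    (x := (Finset.univ : Finset (Fin n)))
  rw [Finset.powerset_univ, Finset.card_univ, Fintype.card_fin] at this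
  rw [this]
  calc _ = ∑ _k ∈ Finset.range (n + 1), (1 : ℝ) := by
        refine Finset.sum_congr rfl fun k hk => ?_
        have : (0 : ℝ) < (n.choose k : ℕ) := by
          exact_mod_cast Nat.choose_pos (Nat.lt_succ_iff.1 (Finset.mem_range.1 hk))
        rw [nsmul_eq_mul, mul_inv_cancel₀ this.ne']
    _ = n + 1 := by simp

end Entropy

/-! ### The three random events: light pairs, degrees, discrepancy -/

section Concentration

theorem measureReal_exists_le {Ω ι : Type*} [MeasurableSpace Ω] {μ : Measure Ω}
    [IsFiniteMeasure μ] (s : Finset ι) {P : ι → Ω → Prop} {b : ι → ℝ}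
    (h : ∀ i ∈ s, μ.real {ω | P i ω} ≤ b i) :
    μ.real {ω | ∃ i ∈ s, P i ω} ≤ ∑ i ∈ s, b i := by
  have h1 : {ω | ∃ i ∈ s, P i ω} = ⋃ i ∈ s, {ω | P i ω} := by ext; simp
  rw [h1]
  exact (measureReal_biUnion_finset_le s _).trans (Finset.sum_le_sum h)

/-- The product of two coordinates if it is small, as a function of the pair of indices. -/
noncomputable def lightPart {n : ℕ} (r : ℝ) (x y : Fin n → ℝ) (i j : Fin n) : ℝ :=
  if 3 * r / n < |x i| * |y j| then 0 else x i * y j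

theorem abs_lightPart_le {n : ℕ} {r : ℝ} (hr : 0 ≤ r) (x y : Fin n → ℝ) (i j : Fin n) :
    |lightPart r x y i j| ≤ 3 * r / n := by
  unfold lightPart
  split_ifs with h
  · rw [abs_zero]; positivity
  · rw [abs_mul]; exact not_lt.1 h

theorem lightPart_sq_le {n : ℕ} (r : ℝ) (x y : Fin n → ℝ) (i j : Fin n) :
    lightPart r x y i j ^ 2 ≤ x i ^ 2 * y j ^ 2 := by
  unfold lightPart
  split_ifs with h
  · rw [zero_pow two_ne_zero]; positivity
  · rw [mul_pow]

variable {Ω : Type*} [MeasurableSpace Ω] {μ : Measure Ω} [IsProbabilityMeasure μ]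
  {n d k : ℕ} {p q : ℝ} {Φ : Fin n → Fin k} {W : Edge n d → Ω → ℝ}

theorem IsSample.measureReal_light_le (h : IsSample μ p q Φ W) (hd : 2 ≤ d) (hn : 0 < n)
    (hqp : q ≤ p) (hp : 0 ≤ p) {r : ℝ} (hr : 0 < r)
    (hrD : r ^ 2 = n * ((n - 2).choose (d - 2) : ℝ) * p) {x y : Fin n → ℝ}
    (hx : ∑ i, x i ^ 2 ≤ 1) (hy : ∑ i, y i ^ 2 ≤ 1) :
    μ.real {ω | 48 * (d : ℝ) ^ 2 * r ≤
      ∑ e, pairSum (lightPart r x y) e * (W e ω - ∫ ω, W e ω ∂μ)} ≤ Real.exp (-(15 * n)) := by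
  have hnR : (0 : ℝ) < n := by exact_mod_cast hn
  have hd0 : (0 : ℝ) < (d : ℝ) ^ 2 := by
    have : (0 : ℝ) < d := by exact_mod_cast (by omega : 0 < d)
    positivity
  have hd1 : (1 : ℝ) ≤ (d : ℝ) ^ 2 := by
    have : (1 : ℝ) ≤ d := by exact_mod_cast (by omega : 1 ≤ d)
    nlinarith
  -- The largest `t` that the bound `d² · 3r/n` on the coefficients permits. The quadratic term is
  -- then at most `n` and the linear one is `16n`, which explains 48.
  refine (measureReal_centered_sum_ge_le h.measurable h.indep h.mem_Icc (h.mean_le hqp)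
    (t := n / (3 * (d : ℝ) ^ 2 * r)) (by positivity) (fun e => ?_) _).trans
    (Real.exp_le_exp.2 ?_)
  · have := abs_pairSum_le (by positivity) (abs_lightPart_le hr.le x y) e
    calc _ ≤ n / (3 * (d : ℝ) ^ 2 * r) * ((d : ℝ) ^ 2 * (3 * r / n)) := by gcongr
      _ = 1 := by field_simp
  · have h1 : ∑ e : Edge n d, pairSum (lightPart r x y) e ^ 2 ≤
        (d : ℝ) ^ 2 * ((n - 2).choose (d - 2) : ℝ) := by
      calc _ ≤ ∑ e : Edge n d, (d : ℝ) ^ 2 * pairSum (fun i j => lightPart r x y i j ^ 2) e :=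
            Finset.sum_le_sum fun e _ => pairSum_sq_le _ _
        _ = (d : ℝ) ^ 2 * ∑ e : Edge n d, pairSum (fun i j => lightPart r x y i j ^ 2) e := by
            rw [Finset.mul_sum]
        _ ≤ (d : ℝ) ^ 2 * (((n - 2).choose (d - 2) : ℝ) *
              ∑ i, ∑ j, lightPart r x y i j ^ 2) := by
            gcongr
            exact sum_pairSum_le hd fun _ _ => sq_nonneg _
        _ ≤ (d : ℝ) ^ 2 * (((n - 2).choose (d - 2) : ℝ) * ∑ i, ∑ j, x i ^ 2 * y j ^ 2) := by
            gcongr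
            exact lightPart_sq_le _ _ _ _ _
        _ ≤ (d : ℝ) ^ 2 * (((n - 2).choose (d - 2) : ℝ) * (1 * 1)) := by
            rw [← Finset.sum_mul_sum]
            gcongr
        _ = _ := by ring
    have h2 : (n / (3 * (d : ℝ) ^ 2 * r)) ^ 2 * p *
        ∑ e : Edge n d, pairSum (lightPart r x y) e ^ 2 ≤ n / (9 * (d : ℝ) ^ 2) := by
      calc _ ≤ (n / (3 * (d : ℝ) ^ 2 * r)) ^ 2 * p *
            ((d : ℝ) ^ 2 * ((n - 2).choose (d - 2) : ℝ)) := by gcongr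
        _ = n * (n * ((n - 2).choose (d - 2) : ℝ) * p) / (9 * (d : ℝ) ^ 2 * r ^ 2) := by
          field_simp; ring
        _ = n / (9 * (d : ℝ) ^ 2) := by rw [← hrD]; field_simp
    have h3 : n / (9 * (d : ℝ) ^ 2) ≤ n := div_le_self hnR.le (by linarith)
    have h4 : n / (3 * (d : ℝ) ^ 2 * r) * (48 * (d : ℝ) ^ 2 * r) = 16 * n := by
      field_simp; norm_num
    rw [h4]
    linarith

/-- The net has at most `25^n ≤ e^{4n}` pairs of points, so `e^{-11n} ≤ n⁻¹¹` remains of `e^{-15n}`.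
-/
theorem IsSample.measureReal_exists_light_le (h : IsSample μ p q Φ W) (hd : 2 ≤ d) (hn : 0 < n)
    (hqp : q ≤ p) (hp : 0 ≤ p) {r : ℝ} (hr : 0 < r)
    (hrD : r ^ 2 = n * ((n - 2).choose (d - 2) : ℝ) * p)
    {s : Finset (EuclideanSpace ℝ (Fin n))} (hs : s.card ≤ 5 ^ n) (hs1 : ∀ x ∈ s, ‖x‖ ≤ 1) :
    μ.real {ω | ∃ z ∈ s ×ˢ s, 48 * (d : ℝ) ^ 2 * r ≤
      ∑ e, pairSum (lightPart r z.1 z.2) e * (W e ω - ∫ ω, W e ω ∂μ)} ≤ ((n : ℝ) ^ 11)⁻¹ := by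
  have hs2 : ∀ x ∈ s, ∑ i, x i ^ 2 ≤ 1 := fun x hx => by
    rw [← EuclideanSpace.real_norm_sq_eq]
    exact pow_le_one₀ (norm_nonneg _) (hs1 x hx)
  refine (measureReal_exists_le (s ×ˢ s) fun z hz =>
    h.measureReal_light_le hd hn hqp hp hr hrD (hs2 _ (Finset.mem_product.1 hz).1)
      (hs2 _ (Finset.mem_product.1 hz).2)).trans ?_
  have hnR : (0 : ℝ) < n := by exact_mod_cast hn
  have h25 : (25 : ℝ) ≤ Real.exp 4 := by
    have := Real.exp_one_gt_d9
    calc (25 : ℝ) ≤ 2.7 ^ 4 := by norm_num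
      _ ≤ Real.exp 1 ^ 4 := by gcongr; linarith
      _ = Real.exp 4 := by rw [← Real.exp_nat_mul]; norm_num
  have hlog : Real.log n ≤ n := (Real.log_le_sub_one_of_pos hnR).trans (by linarith)
  rw [Finset.sum_const, Finset.card_product, nsmul_eq_mul, ← exp_neg_mul_log hn]
  calc ((s.card * s.card : ℕ) : ℝ) * Real.exp (-(15 * n))
      ≤ ((5 ^ n * 5 ^ n : ℕ) : ℝ) * Real.exp (-(15 * n)) := by gcongr
    _ = 25 ^ n * Real.exp (-(15 * n)) := by
      push_cast
      rw [← mul_pow]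
      norm_num
    _ ≤ Real.exp 4 ^ n * Real.exp (-(15 * n)) := by gcongr
    _ = Real.exp (-(11 * n)) := by
      rw [← Real.exp_nat_mul, ← Real.exp_add]
      congr 1
      ring
    _ ≤ Real.exp (-((11 : ℕ) * Real.log n)) := by
      rw [Real.exp_le_exp]
      push_cast
      linarith

/-- Chernoff's bound for a sum of entries of the similarity matrix. -/
theorem IsSample.measureReal_sum_similarity_ge_le (h : IsSample μ p q Φ W) (hd : 2 ≤ d)
    (hqp : q ≤ p) (hp : 0 ≤ p) {f : Fin n → Fin n → ℝ} (hf : ∀ i j, f i j ∈ Set.Icc (0 : ℝ) 1)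
    {t : ℝ} (ht : 0 ≤ t) (r : ℝ) :
    μ.real {ω | r ≤ ∑ i, ∑ j, f i j * (similarity (fun e => W e ω) i j / (d : ℝ) ^ 2)} ≤
      Real.exp (((n - 2).choose (d - 2) : ℝ) * p * (∑ i, ∑ j, f i j) * (Real.exp t - 1) -
        t * r) := by
  have hd1 : (1 : ℝ) ≤ (d : ℝ) ^ 2 := by
    have : (1 : ℝ) ≤ d := by exact_mod_cast (by omega : 1 ≤ d)
    nlinarith
  have hd0 : (0 : ℝ) < (d : ℝ) ^ 2 := by linarith
  have hps : ∀ e : Edge n d, 0 ≤ pairSum f e := pairSum_nonneg fun i j => (hf i j).1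
  -- An edge has `d²` ordered pairs of vertices, so division by `d²` brings the coefficients into
  -- `[0, 1]`.
  have h1 := measureReal_weighted_sum_ge_le h.measurable h.indep h.mem_Icc (h.mean_le hqp)
    (c := fun e => pairSum f e / (d : ℝ) ^ 2)
    (m := ((n - 2).choose (d - 2) : ℝ) * p * (∑ i, ∑ j, f i j))
    (fun e => ⟨div_nonneg (hps e) hd0.le, by
      rw [div_le_one hd0]
      have := abs_pairSum_le (b := 1) zero_le_one
        (fun i j => abs_le.2 ⟨by linarith [(hf i j).1], (hf i j).2⟩) e
      linarith [le_abs_self (pairSum f e)]⟩)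
    (by
      rw [← Finset.sum_div]
      calc p * ((∑ e : Edge n d, pairSum f e) / (d : ℝ) ^ 2) ≤ p * ∑ e : Edge n d, pairSum f e := by
            gcongr
            exact div_le_self (Finset.sum_nonneg fun e _ => hps e) hd1
        _ ≤ p * (((n - 2).choose (d - 2) : ℝ) * ∑ i, ∑ j, f i j) := by
            gcongr
            exact sum_pairSum_le hd fun i j => (hf i j).1
        _ = _ := by ring) ht r
  convert h1 using 4 with ω
  have h2 := sum_mul_similarity f fun e => W e ω
  simp only [← mul_div_assoc, ← Finset.sum_div, div_mul_eq_mul_div]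
  rw [h2]

/-- Chernoff at `t = 1` gives the exponent `(e - 1)D - 14D ≤ -12D ≤ -12 log n`; one power of `n`
pays for the vertices. -/
theorem IsSample.measureReal_exists_degree_le (h : IsSample μ p q Φ W) (hd : 2 ≤ d) (hn : 0 < n)
    (hqp : q ≤ p) (hp : 0 ≤ p)
    (hD : Real.log n ≤ n * ((n - 2).choose (d - 2) : ℝ) * p) :
    μ.real {ω | ∃ i ∈ Finset.univ, 14 * (n * ((n - 2).choose (d - 2) : ℝ) * p) ≤
      ∑ j, similarity (fun e => W e ω) i j / (d : ℝ) ^ 2} ≤ ((n : ℝ) ^ 11)⁻¹ := by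
  have hnR : (0 : ℝ) < n := by exact_mod_cast hn
  refine (measureReal_exists_le Finset.univ (b := fun _ => ((n : ℝ) ^ 12)⁻¹)
    fun i _ => ?_).trans (le_of_eq ?_)
  · have h1 := h.measureReal_sum_similarity_ge_le hd hqp hp
      (f := fun a _ => if a = i then 1 else 0) (fun a b => by split_ifs <;> simp) zero_le_one
      (14 * (n * ((n - 2).choose (d - 2) : ℝ) * p))
    simp only [ite_mul, one_mul, zero_mul, Finset.sum_ite_irrel, Finset.sum_const_zero,
      Finset.sum_ite_eq', Finset.mem_univ, if_true, Finset.sum_const, Finset.card_univ,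
      Fintype.card_fin, nsmul_eq_mul, mul_one] at h1
    refine h1.trans ?_
    rw [← exp_neg_mul_log hn, Real.exp_le_exp]
    have h2 := Real.exp_one_lt_three
    have h3 : ((n - 2).choose (d - 2) : ℝ) * p * n = n * ((n - 2).choose (d - 2) : ℝ) * p := by
      ring
    have h4 : 0 ≤ n * ((n - 2).choose (d - 2) : ℝ) * p := by positivity
    rw [h3]
    push_cast
    nlinarith
  · rw [Finset.sum_const, Finset.card_univ, Fintype.card_fin, nsmul_eq_mul]
    field_simp

/-- Uniformity in `t` is essential, because the `τ` used for heavy pairs depends on the level sets.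
Each size of set contributes 1 to the sum of inverse binomials, so the union bound gives `(n + 1)²
n⁻¹⁶ ≤ n⁻¹²`. -/
theorem IsSample.measureReal_exists_dense_le (h : IsSample μ p q Φ W) (hd : 2 ≤ d) (hn : 2 ≤ n)
    (hqp : q ≤ p) (hp : 0 ≤ p) :
    μ.real {ω | ∃ z ∈ (Finset.univ.filter fun S : Finset (Fin n) => S.Nonempty) ×ˢ
        (Finset.univ.filter fun S : Finset (Fin n) => S.Nonempty), ∃ t, 0 < t ∧
      (n * ((n - 2).choose (d - 2) : ℝ) * p) / n * z.1.card * z.2.card * Real.exp t +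
        9 * (z.1.card * (1 + Real.log (n / z.1.card)) +
          z.2.card * (1 + Real.log (n / z.2.card))) <
      t * ∑ i ∈ z.1, ∑ j ∈ z.2, similarity (fun e => W e ω) i j / (d : ℝ) ^ 2} ≤
      ((n : ℝ) ^ 11)⁻¹ := by
  have hnR : (2 : ℝ) ≤ n := by exact_mod_cast hn
  have hn0 : (0 : ℝ) < n := by linarith
  have hcard : ∀ S : Finset (Fin n), S.card ≤ n := fun S => by
    simpa using Finset.card_le_univ S
  refine (measureReal_exists_le _ (b := fun z => (((n.choose z.1.card : ℕ) : ℝ)⁻¹ *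
    ((n : ℝ) ^ 8)⁻¹) * (((n.choose z.2.card : ℕ) : ℝ)⁻¹ * ((n : ℝ) ^ 8)⁻¹))
    fun z hz => ?_).trans ?_
  · simp only [Finset.mem_product, Finset.mem_filter, Finset.mem_univ, true_and] at hz
    have hE : ∀ S : Finset (Fin n), S.Nonempty → 0 ≤ S.card * (1 + Real.log (n / S.card)) :=
      fun S hS => (Real.log_nonneg (by linarith)).trans (log_le_entropy hS.card_pos (hcard S))
    have h1 := hE _ hz.1
    have h2 := hE _ hz.2
    refine (measureReal_exists_lt_mul_le (by positivity) (by positivity) fun t ht r => ?_).trans ?_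
    · have h3 := h.measureReal_sum_similarity_ge_le hd hqp hp
        (f := fun i j => if i ∈ z.1 then (if j ∈ z.2 then 1 else 0) else 0)
        (fun i j => by split_ifs <;> simp) ht r
      simp only [ite_mul, one_mul, zero_mul, Finset.sum_ite_irrel, Finset.sum_const_zero,
        Finset.sum_ite_mem, Finset.univ_inter, Finset.sum_const, nsmul_eq_mul, mul_one] at h3
      refine h3.trans (Real.exp_le_exp.2 (le_of_eq ?_))
      field_simp
    · rw [mul_add, neg_add, Real.exp_add]
      gcongr
      · exact exp_neg_nine_mul_entropy_le hz.1.card_pos (hcard _)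
      · exact exp_neg_nine_mul_entropy_le hz.2.card_pos (hcard _)
  · have h1 : ∑ S ∈ Finset.univ.filter (fun S : Finset (Fin n) => S.Nonempty),
        ((n.choose S.card : ℕ) : ℝ)⁻¹ * ((n : ℝ) ^ 8)⁻¹ ≤ (n : ℝ) ^ 2 * ((n : ℝ) ^ 8)⁻¹ := by
      rw [← Finset.sum_mul]
      gcongr
      calc _ ≤ ∑ S : Finset (Fin n), ((n.choose S.card : ℕ) : ℝ)⁻¹ :=
            Finset.sum_le_sum_of_subset_of_nonneg (Finset.filter_subset _ _)
              fun _ _ _ => by positivity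
        _ = n + 1 := sum_inv_choose_card n
        _ ≤ (n : ℝ) ^ 2 := by nlinarith
    rw [Finset.sum_product]
    simp only
    rw [← Finset.sum_mul_sum]
    calc _ ≤ ((n : ℝ) ^ 2 * ((n : ℝ) ^ 8)⁻¹) * ((n : ℝ) ^ 2 * ((n : ℝ) ^ 8)⁻¹) :=
          mul_le_mul h1 h1 (Finset.sum_nonneg fun _ _ => by positivity) (by positivity)
      _ = ((n : ℝ) ^ 12)⁻¹ := by field_simp
      _ ≤ ((n : ℝ) ^ 11)⁻¹ := by
        gcongr
        · linarith
        · norm_num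

end Concentration

/-! ### The spectral norm bound -/

section SpectralBound

theorem inner_toEuclideanCLM_eq_sum {n : ℕ} (A : Matrix (Fin n) (Fin n) ℝ)
    (x y : EuclideanSpace ℝ (Fin n)) :
    inner ℝ x (Matrix.toEuclideanCLM (n := Fin n) (𝕜 := ℝ) A y) =
      ∑ i, ∑ j, x i * y j * A i j := by
  rw [Matrix.inner_toEuclideanCLM]
  simp only [dotProduct, Matrix.mulVec, Finset.mul_sum]
  exact Finset.sum_congr rfl fun i _ => Finset.sum_congr rfl fun j _ => by ring

/-- The contribution of the large products to the bilinear form of a matrix with small entries. -/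
theorem sum_heavy_le_of_le {n : ℕ} {A : Fin n → Fin n → ℝ} {r : ℝ} (hr : 0 < r) (hn : 0 < n)
    (hA : ∀ i j, A i j ≤ r ^ 2 / n) {x y : Fin n → ℝ} (hx : ∑ i, x i ^ 2 ≤ 1)
    (hy : ∑ i, y i ^ 2 ≤ 1) :
    ∑ i, ∑ j, (if 3 * r / n < |x i| * |y j| then A i j * (|x i| * |y j|) else 0) ≤ r := by
  have hnR : (0 : ℝ) < n := by exact_mod_cast hn
  have h1 : ∀ i j, (if 3 * r / n < |x i| * |y j| then A i j * (|x i| * |y j|) else 0) ≤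
      r * (x i ^ 2 * y j ^ 2) := by
    intro i j
    split_ifs with h
    · have h0 : 0 ≤ |x i| * |y j| := by positivity
      have h2 : r / n ≤ |x i| * |y j| := le_trans (by gcongr; linarith) h.le
      calc A i j * (|x i| * |y j|) ≤ r ^ 2 / n * (|x i| * |y j|) := by gcongr; exact hA i j
        _ = r * ((r / n) * (|x i| * |y j|)) := by ring
        _ ≤ r * ((|x i| * |y j|) * (|x i| * |y j|)) := by gcongr
        _ = r * (x i ^ 2 * y j ^ 2) := by rw [← sq_abs (x i), ← sq_abs (y j)]; ring
    · positivity
  calc _ ≤ ∑ i, ∑ j, r * (x i ^ 2 * y j ^ 2) :=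
        Finset.sum_le_sum fun i _ => Finset.sum_le_sum fun j _ => h1 i j
    _ = r * ((∑ i, x i ^ 2) * ∑ j, y j ^ 2) := by
        rw [Finset.sum_mul_sum]; simp only [Finset.mul_sum]
    _ ≤ r * (1 * 1) := by
        gcongr
    _ = r := by ring

/-- A constant for the spectral norm bound. -/
noncomputable def spectralConst (d : ℕ) : ℝ := 4 * (44208 * (d : ℝ) ^ 2 + 1)

theorem spectralConst_pos (d : ℕ) : 0 < spectralConst d := by
  unfold spectralConst
  positivity

theorem bilinear_le {n d : ℕ} (hd : 2 ≤ d) (hn : 0 < n) {p D : ℝ} (hp : 0 ≤ p) (hD : 0 < D)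
    (hDp : D = n * ((n - 2).choose (d - 2) : ℝ) * p) {w m : Edge n d → ℝ}
    (hw : ∀ e, 0 ≤ w e) (hm : ∀ e, 0 ≤ m e) (hmp : ∀ e, m e ≤ p)
    {x y : Fin n → ℝ} (hx : ∑ i, x i ^ 2 ≤ 1) (hy : ∑ i, y i ^ 2 ≤ 1)
    (hlight : ∑ e, pairSum (lightPart √D x y) e * (w e - m e) ≤ 48 * (d : ℝ) ^ 2 * √D)
    (hdeg : ∀ i, ∑ j, similarity w i j / (d : ℝ) ^ 2 ≤ 14 * D)
    (hdisc : ∀ S T : Finset (Fin n), S.Nonempty → T.Nonempty → ∀ τ, 0 < τ →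
      τ * ∑ i ∈ S, ∑ j ∈ T, similarity w i j / (d : ℝ) ^ 2 ≤
        D / n * S.card * T.card * Real.exp τ +
        9 * (S.card * (1 + Real.log (n / S.card)) + T.card * (1 + Real.log (n / T.card)))) :
    ∑ i, ∑ j, x i * y j * (similarity w - similarity m) i j ≤
      (44208 * (d : ℝ) ^ 2 + 1) * √D := by
  have hd0 : (0 : ℝ) < (d : ℝ) ^ 2 := by
    have : (0 : ℝ) < d := by exact_mod_cast (by omega : 0 < d)
    positivity
  have hr : 0 < √D := Real.sqrt_pos.2 hD
  have hrD : √D ^ 2 = D := Real.sq_sqrt hD.le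
  have hnR : (0 : ℝ) < n := by exact_mod_cast hn
  have hheavy := sum_heavy_le (M := fun i j => similarity w i j / (d : ℝ) ^ 2) hD
    (show (0 : ℝ) ≤ 9 by norm_num) (show (0 : ℝ) ≤ 14 by norm_num)
    (fun i j => div_nonneg (similarity_nonneg hw i j) hd0.le) hdeg
    (fun j => by simpa only [similarity_symm w _ j] using hdeg j) hdisc hx hy
  have hmean := sum_heavy_le_of_le (A := similarity m) hr hn (fun i j => by
    rw [hrD, hDp, mul_assoc, mul_div_cancel_left₀ _ hnR.ne']
    exact similarity_le hd hp hmp i j) hx hy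
  have hlight' : ∑ i, ∑ j, lightPart √D x y i j * (similarity w i j - similarity m i j) ≤
      48 * (d : ℝ) ^ 2 * √D := by
    simp only [mul_sub, Finset.sum_sub_distrib] at hlight ⊢
    rwa [sum_mul_similarity, sum_mul_similarity]
  have hterm : ∀ i j, x i * y j * (similarity w - similarity m) i j ≤
      lightPart √D x y i j * (similarity w i j - similarity m i j) +
      (d : ℝ) ^ 2 * (if 3 * √D / n < |x i| * |y j| then
        similarity w i j / (d : ℝ) ^ 2 * (|x i| * |y j|) else 0) +
      (if 3 * √D / n < |x i| * |y j| then similarity m i j * (|x i| * |y j|) else 0) := by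
    intro i j
    have hA := similarity_nonneg hw i j
    have hM := similarity_nonneg hm i j
    have hxy := neg_abs_le (x i * y j)
    have hxy' := le_abs_self (x i * y j)
    rw [abs_mul] at hxy hxy'
    rw [Matrix.sub_apply]
    unfold lightPart
    split_ifs
    · rw [div_mul_eq_mul_div, mul_div_cancel₀ _ hd0.ne']
      nlinarith
    · simp
  have hsum := Finset.sum_le_sum fun i (_ : i ∈ Finset.univ) =>
    Finset.sum_le_sum fun j (_ : j ∈ Finset.univ) => hterm i j
  simp only [Finset.sum_add_distrib, ← Finset.mul_sum] at hsum
  -- `44208 = 48 + 640 (1 + 6·9 + 14)`: light pairs, then heavy pairs with `K = 9` and `B = 14`. The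
  -- final `+ 1` is the heavy part of the mean matrix.
  refine hsum.trans ?_
  have := mul_le_mul_of_nonneg_left hheavy hd0.le
  linarith

theorem isSpectralConstant_spectralConst {d : ℕ} (hd : 2 ≤ d) :
    IsSpectralConstant.{u} d 1 (spectralConst d) := by
  intro n k p q Φ Ω _ μ _ W hdn hq hqp hp1 h hlog
  rw [one_mul] at hlog
  have hn : 2 ≤ n := hd.trans hdn
  have hn0 : 0 < n := by omega
  have hp : 0 ≤ p := hq.trans hqp.le
  have hnR : (2 : ℝ) ≤ n := by exact_mod_cast hn
  obtain ⟨D, hD⟩ : ∃ D, D = n * ((n - 2).choose (d - 2) : ℝ) * p := ⟨_, rfl⟩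
  have hD0 : 0 < D := by rw [hD]; exact (Real.log_pos (by linarith)).trans_le hlog
  have hr : 0 < √D := Real.sqrt_pos.2 hD0
  obtain ⟨s, hs, hs1, hnet⟩ := exists_half_net (EuclideanSpace ℝ (Fin n))
  rw [finrank_euclideanSpace, Fintype.card_fin] at hs
  have b1 := h.measureReal_exists_light_le hd hn0 hqp.le hp hr
    (by rw [Real.sq_sqrt hD0.le, hD]) hs hs1
  have b2 := h.measureReal_exists_degree_le hd hn0 hqp.le hp hlog
  have b3 := h.measureReal_exists_dense_le hd hn hqp.le hp
  rw [← hD] at b2 b3 ⊢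
  set B1 : Set Ω := {ω | ∃ z ∈ s ×ˢ s, 48 * (d : ℝ) ^ 2 * √D ≤
      ∑ e, pairSum (lightPart √D z.1 z.2) e * (W e ω - ∫ ω, W e ω ∂μ)} with hB1
  set B2 : Set Ω := {ω | ∃ i ∈ Finset.univ, 14 * D ≤
      ∑ j, similarity (fun e => W e ω) i j / (d : ℝ) ^ 2} with hB2
  set B3 : Set Ω := {ω | ∃ z ∈ (Finset.univ.filter fun S : Finset (Fin n) => S.Nonempty) ×ˢ
        (Finset.univ.filter fun S : Finset (Fin n) => S.Nonempty), ∃ t, 0 < t ∧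
      D / n * z.1.card * z.2.card * Real.exp t +
        9 * (z.1.card * (1 + Real.log (n / z.1.card)) +
          z.2.card * (1 + Real.log (n / z.2.card))) <
      t * ∑ i ∈ z.1, ∑ j ∈ z.2, similarity (fun e => W e ω) i j / (d : ℝ) ^ 2} with hB3
  set G : Set Ω := {ω | spectralNorm (similarity (fun e => W e ω) - meanSimilarity μ W) ≤
    spectralConst d * √D} with hG
  -- Covering the space bounds the measure of `G` from below without measurability of any of these
  -- sets.
  have hcover : Set.univ ⊆ G ∪ (B1 ∪ B2 ∪ B3) := by
    intro ω _
    by_contra hω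
    simp only [Set.mem_union, not_or] at hω
    obtain ⟨hωG, ⟨hω1, hω2⟩, hω3⟩ := hω
    refine hωG ?_
    simp only [hB1, hB2, hB3, Set.mem_ofPred_eq, not_exists, not_and, not_le, not_lt]
      at hω1 hω2 hω3
    simp only [hG, Set.mem_ofPred_eq, spectralNorm, spectralConst]
    rw [mul_assoc]
    refine opNorm_le_of_half_net hnet fun x hx y hy => ?_
    have hs2 : ∀ x ∈ s, ∑ i, x i ^ 2 ≤ 1 := fun x hx => by
      rw [← EuclideanSpace.real_norm_sq_eq]
      exact pow_le_one₀ (norm_nonneg _) (hs1 x hx)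
    rw [inner_toEuclideanCLM_eq_sum, h.meanSimilarity_eq]
    exact bilinear_le hd hn0 hp hD0 hD (fun e => (h.mem_Icc e ω).1)
      (fun e => integral_nonneg fun ω => (h.mem_Icc e ω).1) (h.mean_le hqp.le)
      (hs2 x hx) (hs2 y hy) (hω1 (x, y) (Finset.mk_mem_product hx hy)).le
      (fun i => (hω2 i (Finset.mem_univ i)).le)
      fun S T hS hT τ hτ => hω3 (S, T) (by simp [hS, hT]) τ hτ
  have h1 : 1 ≤ μ.real G + (μ.real B1 + μ.real B2 + μ.real B3) := by
    calc (1 : ℝ) = μ.real Set.univ := by simp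
      _ ≤ μ.real (G ∪ (B1 ∪ B2 ∪ B3)) := measureReal_mono hcover
      _ ≤ μ.real G + μ.real (B1 ∪ B2 ∪ B3) := measureReal_union_le _ _
      _ ≤ μ.real G + (μ.real B1 + μ.real B2 + μ.real B3) := by
        gcongr
        exact (measureReal_union_le _ _).trans (by gcongr; exact measureReal_union_le _ _)
  -- The failure probability is at most `3 n⁻¹¹`; the fourth `n⁻¹¹` makes the inequality strict.
  have h2 : 0 < ((n : ℝ) ^ 11)⁻¹ := by positivity
  linarith

end SpectralBound

/-! ### Eigenvalues and estimators near a balanced block matrix -/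

section BlockSpectrum

variable {n k s : ℕ} {Φ : Fin n → Fin k}

theorem Balanced.mul_eq (h : Balanced Φ s) : k * s = n := by
  have h1 := Finset.card_eq_sum_card_fiberwise (f := Φ) (s := Finset.univ) (t := Finset.univ)
    (fun _ _ => Finset.mem_coe.2 (Finset.mem_univ _))
  rw [Finset.sum_congr rfl fun a _ => h a] at h1
  simpa using h1.symm

/-- The sum of the coordinates over a community. -/
def communitySum (Φ : Fin n → Fin k) (x : Fin n → ℝ) (a : Fin k) : ℝ :=
  ∑ i ∈ Finset.univ.filter fun i => Φ i = a, x i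

/-- The quadratic form of a block matrix with zero diagonal, with the entries `Δ + Q` inside the
communities and `Q` between them. -/
def blockForm (Φ : Fin n → Fin k) (Δ Q : ℝ) (x : Fin n → ℝ) : ℝ :=
  Δ * ∑ a, communitySum Φ x a ^ 2 + Q * (∑ i, x i) ^ 2 - (Δ + Q) * ∑ i, x i ^ 2

/-- `B` is `Δ` times the same-community indicator plus `Q` times the all-ones matrix, minus `Δ + Q`
times the identity, which cancels the diagonal. -/
theorem sum_eq_blockForm {B : Matrix (Fin n) (Fin n) ℝ} {Δ Q : ℝ} (hdiag : ∀ i, B i i = 0)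
    (hwithin : ∀ i j, i ≠ j → Φ i = Φ j → B i j = Δ + Q) (hcross : ∀ i j, Φ i ≠ Φ j → B i j = Q)
    (x : Fin n → ℝ) : ∑ i, ∑ j, x i * x j * B i j = blockForm Φ Δ Q x := by
  have h1 : ∀ i j, x i * x j * B i j = Δ * (if Φ j = Φ i then x i * x j else 0) +
      Q * (x i * x j) - (Δ + Q) * (if i = j then x i * x j else 0) := by
    intro i j
    by_cases hij : i = j
    · subst hij
      simp only [hdiag, if_true]
      ring
    by_cases hΦ : Φ i = Φ j
    · rw [hwithin i j hij hΦ, if_pos hΦ.symm, if_neg hij]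
      ring
    · rw [hcross i j hΦ, if_neg (Ne.symm hΦ), if_neg hij]
      ring
  have h2 : ∑ i, ∑ j, (if Φ j = Φ i then x i * x j else 0) = ∑ a, communitySum Φ x a ^ 2 := by
    have h3 : ∀ a, communitySum Φ x a ^ 2 =
        ∑ i ∈ Finset.univ.filter (fun i => Φ i = a), x i * communitySum Φ x (Φ i) := fun a => by
      rw [sq]
      conv_lhs => rw [communitySum, Finset.sum_mul]
      refine Finset.sum_congr rfl fun i hi => ?_
      rw [(Finset.mem_filter.1 hi).2]
      rfl
    simp_rw [h3]
    rw [Finset.sum_fiberwise]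
    refine Finset.sum_congr rfl fun i _ => ?_
    rw [communitySum, Finset.mul_sum, Finset.sum_filter]
  simp_rw [h1, Finset.sum_sub_distrib, Finset.sum_add_distrib, ← Finset.mul_sum]
  rw [h2, blockForm]
  congr 2
  · rw [sq, Finset.sum_mul_sum]
    simp only [Finset.mul_sum]
  · simp [sq]

theorem Balanced.sum_communitySum_sq_le (h : Balanced Φ s) (x : Fin n → ℝ) :
    ∑ a, communitySum Φ x a ^ 2 ≤ s * ∑ i, x i ^ 2 := by
  calc _ ≤ ∑ a, (s : ℝ) * ∑ i ∈ Finset.univ.filter (fun i => Φ i = a), x i ^ 2 := by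
        refine Finset.sum_le_sum fun a _ => ?_
        rw [← h a]
        exact sq_sum_le_card_mul_sum_sq
    _ = s * ∑ i, x i ^ 2 := by rw [← Finset.mul_sum, Finset.sum_fiberwise]

theorem Balanced.sum_comp (h : Balanced Φ s) (f : Fin k → ℝ) : ∑ i, f (Φ i) = s * ∑ a, f a := by
  rw [← Finset.sum_fiberwise Finset.univ Φ, Finset.mul_sum]
  refine Finset.sum_congr rfl fun a _ => ?_
  rw [Finset.sum_congr rfl (g := fun _ => f a) fun i hi => by rw [(Finset.mem_filter.1 hi).2],
    Finset.sum_const, h a, nsmul_eq_mul]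

theorem Balanced.communitySum_comp (h : Balanced Φ s) (z : Fin k → ℝ) (a : Fin k) :
    communitySum Φ (fun i => z (Φ i)) a = s * z a := by
  rw [communitySum, Finset.sum_congr rfl (g := fun _ => z a) fun i hi => by
    rw [(Finset.mem_filter.1 hi).2], Finset.sum_const, h a, nsmul_eq_mul]

variable {A : Matrix (Fin n) (Fin n) ℝ} {Δ Q δ : ℝ}

/-- The quadratic form of `A` is `δ`-close to the one of a block matrix. -/
def NearBlockForm (Φ : Fin n → Fin k) (Δ Q δ : ℝ) (A : Matrix (Fin n) (Fin n) ℝ) : Prop :=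
  ∀ x : EuclideanSpace ℝ (Fin n),
    |inner ℝ x (Matrix.toEuclideanCLM (n := Fin n) (𝕜 := ℝ) A x) - blockForm Φ Δ Q x| ≤
      δ * ‖x‖ ^ 2

theorem eig_one_le (hA : A.IsHermitian) (h : NearBlockForm Φ Δ Q δ A) (hb : Balanced Φ s)
    (hΔ : 0 ≤ Δ) (hQ : 0 ≤ Q) (hn : 1 ≤ n) : eig hA 1 ≤ s * Δ + n * Q - (Δ + Q) + δ := by
  refine eig_le_of_ker hA hn (0 : EuclideanSpace ℝ (Fin n) →ₗ[ℝ] (Fin 0 → ℝ)) (by simp)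
    fun x _ => ?_
  have h1 := (abs_le.1 (h x)).2
  have h2 := mul_le_mul_of_nonneg_left (hb.sum_communitySum_sq_le x) hΔ
  have h3 : (∑ i, x i) ^ 2 ≤ n * ∑ i, x i ^ 2 := by
    simpa using sq_sum_le_card_mul_sum_sq (s := Finset.univ) (f := fun i => x i)
  have h4 := mul_le_mul_of_nonneg_left h3 hQ
  rw [blockForm, ← EuclideanSpace.real_norm_sq_eq] at h1
  rw [← EuclideanSpace.real_norm_sq_eq] at h2 h4
  linarith

/-- On the hyperplane of vectors with zero sum the `Q` term disappears, and one dimension is lost.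
-/
theorem eig_le_of_two_le (hA : A.IsHermitian) (h : NearBlockForm Φ Δ Q δ A) (hb : Balanced Φ s)
    (hΔ : 0 ≤ Δ) {i : ℕ} (hi : 2 ≤ i) (hin : i ≤ n) :
    eig hA i ≤ s * Δ - (Δ + Q) + δ := by
  let f : EuclideanSpace ℝ (Fin n) →ₗ[ℝ] ℝ :=
    { toFun := fun x => ∑ i, x i
      map_add' := fun x y => by simp [Finset.sum_add_distrib]
      map_smul' := fun r x => by simp [Finset.mul_sum] }
  refine eig_le_of_ker hA hin f (by rw [Module.finrank_self]; omega) fun x hx => ?_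
  have hx' : ∑ i, x i = 0 := hx
  have h1 := (abs_le.1 (h x)).2
  have h2 := mul_le_mul_of_nonneg_left (hb.sum_communitySum_sq_le x) hΔ
  rw [blockForm, ← EuclideanSpace.real_norm_sq_eq, hx'] at h1
  rw [← EuclideanSpace.real_norm_sq_eq] at h2
  linarith

/-- On the vectors whose `k` community sums vanish, only the diagonal correction survives. -/
theorem eig_le_of_lt (hA : A.IsHermitian) (h : NearBlockForm Φ Δ Q δ A) {i : ℕ}
    (hi : k < i) (hin : i ≤ n) : eig hA i ≤ -(Δ + Q) + δ := by
  let f : EuclideanSpace ℝ (Fin n) →ₗ[ℝ] (Fin k → ℝ) :=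
    { toFun := fun x => communitySum Φ x
      map_add' := fun x y => by ext; simp [communitySum, Finset.sum_add_distrib]
      map_smul' := fun r x => by ext; simp [communitySum, Finset.mul_sum] }
  refine eig_le_of_ker hA hin f (by rw [Module.finrank_fintype_fun_eq_card]; simpa) fun x hx => ?_
  have hx' : ∀ a, communitySum Φ x a = 0 := fun a => congrFun hx a
  have hx0 : ∑ i, x i = 0 := by
    rw [← Finset.sum_fiberwise Finset.univ Φ]
    exact Finset.sum_eq_zero fun a _ => hx' a
  have h1 := (abs_le.1 (h x)).2
  rw [blockForm, ← EuclideanSpace.real_norm_sq_eq, hx0] at h1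
  simp only [hx'] at h1
  norm_num at h1
  linarith

theorem le_eig (hA : A.IsHermitian) (h : NearBlockForm Φ Δ Q δ A) (hΔ : 0 ≤ Δ) (hQ : 0 ≤ Q)
    {i : ℕ} (hi : 1 ≤ i) (hin : i ≤ n) : -(Δ + Q) - δ ≤ eig hA i := by
  refine le_eig_of_injective hA hi hin LinearMap.id Function.injective_id (by simpa) fun x => ?_
  have h1 := (abs_le.1 (h x)).1
  have h2 : 0 ≤ Δ * ∑ a, communitySum Φ x a ^ 2 :=
    mul_nonneg hΔ (Finset.sum_nonneg fun _ _ => sq_nonneg _)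
  have h3 : 0 ≤ Q * (∑ i, x i) ^ 2 := mul_nonneg hQ (sq_nonneg _)
  rw [blockForm, ← EuclideanSpace.real_norm_sq_eq] at h1
  simp only [LinearMap.id_coe, id_eq]
  linarith

/-- Vectors constant on communities form a `k`-dimensional space on which the Cauchy–Schwarz bound
of `Balanced.sum_communitySum_sq_le` is an equality. -/
theorem le_eig_of_le (hA : A.IsHermitian) (h : NearBlockForm Φ Δ Q δ A) (hb : Balanced Φ s)
    (hs : 0 < s) (hQ : 0 ≤ Q) {i : ℕ} (hi : 1 ≤ i) (hik : i ≤ k) (hin : i ≤ n) :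
    s * Δ - (Δ + Q) - δ ≤ eig hA i := by
  let g : (Fin k → ℝ) →ₗ[ℝ] EuclideanSpace ℝ (Fin n) :=
    { toFun := fun z => WithLp.toLp 2 fun i => z (Φ i)
      map_add' := fun x y => by ext; simp
      map_smul' := fun r x => by ext; simp }
  have hg : ∀ z j, g z j = z (Φ j) := fun _ _ => rfl
  have hinj : Function.Injective g := by
    intro z z' hz
    ext a
    obtain ⟨j, hj⟩ := Finset.card_pos.1 (hs.trans_eq (hb a).symm)
    rw [← (Finset.mem_filter.1 hj).2, ← hg z j, ← hg z' j, hz]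
  refine le_eig_of_injective hA hi hin g hinj
    (by rw [Module.finrank_fintype_fun_eq_card]; simpa) fun z => ?_
  have h1 := (abs_le.1 (h (g z))).1
  have h2 : ‖g z‖ ^ 2 = s * ∑ a, z a ^ 2 := by
    rw [EuclideanSpace.real_norm_sq_eq]
    exact hb.sum_comp fun a => z a ^ 2
  have h3 : ∑ a, communitySum Φ (g z) a ^ 2 = s * ‖g z‖ ^ 2 := by
    rw [h2, Finset.mul_sum, Finset.mul_sum]
    refine Finset.sum_congr rfl fun a _ => ?_
    have : communitySum Φ (g z) a = s * z a := hb.communitySum_comp z a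
    rw [this]
    ring
  have h4 : 0 ≤ Q * (∑ i, g z i) ^ 2 := mul_nonneg hQ (sq_nonneg _)
  rw [blockForm, ← EuclideanSpace.real_norm_sq_eq, h3] at h1
  linarith

theorem le_eig_one (hA : A.IsHermitian) (h : NearBlockForm Φ Δ Q δ A) (hb : Balanced Φ s)
    (hn : 1 ≤ n) : s * Δ + n * Q - (Δ + Q) - δ ≤ eig hA 1 := by
  let g : ℝ →ₗ[ℝ] EuclideanSpace ℝ (Fin n) :=
    { toFun := fun z => WithLp.toLp 2 fun _ => z
      map_add' := fun x y => by ext; simp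
      map_smul' := fun r x => by ext; simp }
  have hg : ∀ z j, g z j = z := fun _ _ => rfl
  have hinj : Function.Injective g := by
    intro z z' hz
    rw [← hg z ⟨0, hn⟩, hz, hg]
  refine le_eig_of_injective hA le_rfl hn g hinj (by rw [Module.finrank_self]) fun z => ?_
  have h1 := (abs_le.1 (h (g z))).1
  have hks : (k : ℝ) * s = n := by exact_mod_cast hb.mul_eq
  have h2 : ‖g z‖ ^ 2 = n * z ^ 2 := by
    rw [EuclideanSpace.real_norm_sq_eq]
    simp [hg]
  have h3 : ∑ a, communitySum Φ (g z) a ^ 2 = s * ‖g z‖ ^ 2 := by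
    rw [h2, ← hks]
    have : ∀ a, communitySum Φ (g z) a = s * z := fun a => hb.communitySum_comp (fun _ => z) a
    simp only [this, Finset.sum_const, Finset.card_univ, Fintype.card_fin, nsmul_eq_mul]
    ring
  have h4 : (∑ i, g z i) ^ 2 = n * ‖g z‖ ^ 2 := by
    rw [h2]
    simp only [hg, Finset.sum_const, Finset.card_univ, Fintype.card_fin, nsmul_eq_mul]
    ring
  rw [blockForm, ← EuclideanSpace.real_norm_sq_eq, h3, h4] at h1
  linarith

theorem nearBlockForm_of_spectralNorm_le {B : Matrix (Fin n) (Fin n) ℝ}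
    (hδ : spectralNorm (A - B) ≤ δ) (hdiag : ∀ i, B i i = 0)
    (hwithin : ∀ i j, i ≠ j → Φ i = Φ j → B i j = Δ + Q)
    (hcross : ∀ i j, Φ i ≠ Φ j → B i j = Q) : NearBlockForm Φ Δ Q δ A := by
  intro x
  have h1 : blockForm Φ Δ Q x =
      inner ℝ x (Matrix.toEuclideanCLM (n := Fin n) (𝕜 := ℝ) B x) := by
    rw [inner_toEuclideanCLM_eq_sum, sum_eq_blockForm hdiag hwithin hcross]
  rw [h1, ← inner_sub_right, ← sub_apply, ← map_sub]
  refine (abs_real_inner_le_norm _ _).trans ?_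
  calc ‖x‖ * ‖Matrix.toEuclideanCLM (n := Fin n) (𝕜 := ℝ) (A - B) x‖
      ≤ ‖x‖ * (δ * ‖x‖) := by
        gcongr
        exact (ContinuousLinearMap.le_opNorm _ _).trans (by gcongr; exact hδ)
    _ = δ * ‖x‖ ^ 2 := by ring

/-- The estimators computed from a matrix that is close to a balanced block matrix. -/
theorem estimators_of_nearBlockForm (hA : A.IsHermitian) (h : NearBlockForm Φ Δ Q δ A)
    (hb : Balanced Φ s) (hk : 2 ≤ k) (hs : 2 ≤ s) (hQ : 0 ≤ Q) (hδ : 0 < δ)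
    (hgap : 8 * δ ≤ s * Δ) {m : ℕ} (hm : m ∈ gapArgmax hA) :
    (m = k ∧ sHat n m = s) ∧
      max |pHat hA m - (Δ + Q)| |qHat hA - Q| ≤ 2 * δ / s ∧
      lambdaHat hA m ∈ Set.Icc (1 / 4 * (Δ + Q) + 3 / 4 * Q) (3 / 4 * (Δ + Q) + 1 / 4 * Q) := by
  have hks := hb.mul_eq
  -- Communities of size at least 2 make `k ≤ n - 1`, so that `k` is an admissible index in the
  -- argmax.
  have hkn : k + 1 ≤ n := by nlinarith
  have hsn : s ≤ n := by nlinarith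
  have hsR : (2 : ℝ) ≤ s := by exact_mod_cast hs
  have hΔ : 0 ≤ Δ := by
    by_contra! hneg
    nlinarith
  have hmid : ∀ i, 2 ≤ i → i ≤ k →
      s * Δ - (Δ + Q) - δ ≤ eig hA i ∧ eig hA i ≤ s * Δ - (Δ + Q) + δ := fun i hi hik =>
    ⟨le_eig_of_le hA h hb (by omega) hQ (by omega) hik (by omega),
      eig_le_of_two_le hA h hb hΔ hi (by omega)⟩
  have hlow : ∀ i, k < i → i ≤ n → -(Δ + Q) - δ ≤ eig hA i ∧ eig hA i ≤ -(Δ + Q) + δ :=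
    fun i hi hin => ⟨le_eig hA h hΔ hQ (by omega) hin, eig_le_of_lt hA h hi hin⟩
  have hmk : m = k := by
    obtain ⟨hm1, hm2⟩ := hm
    rw [Finset.mem_Icc] at hm1
    have h1 := hm2 k (Finset.mem_Icc.2 ⟨hk, by omega⟩)
    have h2 := (hmid k hk le_rfl).1
    have h3 := (hlow (k + 1) (by omega) hkn).2
    -- The gap at `k` is at least `sΔ - 2δ ≥ 6δ`; any other has both eigenvalues in one cluster and
    -- is at most `2δ`. Index 1 must be excluded, as its gap is about `nQ`.
    rcases lt_trichotomy m k with hlt | heq | hgt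
    · have h4 := (hmid m hm1.1 hlt.le).2
      have h5 := (hmid (m + 1) (by omega) hlt).1
      linarith
    · exact heq
    · have h4 := (hlow m hgt (by omega)).2
      have h5 := (hlow (m + 1) (by omega) (by omega)).1
      linarith
  have hkR : (0 : ℝ) < k := by exact_mod_cast (by omega : 0 < k)
  have hnR : (0 : ℝ) < n := by exact_mod_cast (by omega : 0 < n)
  have hsnR : (s : ℝ) ≤ n := by exact_mod_cast hsn
  have hsHat : sHat n m = s := by
    rw [sHat, hmk, div_eq_iff hkR.ne']
    exact_mod_cast (by rw [← hks, mul_comm] : n = s * k)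
  have u1 := eig_one_le hA h hb hΔ hQ (by omega)
  have l1 := le_eig_one hA h hb (by omega)
  obtain ⟨l2, u2⟩ := hmid 2 le_rfl hk
  have hs0 : (0 : ℝ) < s := by linarith
  have hp : |pHat hA m - (Δ + Q)| ≤ 2 * δ / s := by
    have h1 : 0 < n * ((s : ℝ) - 1) := mul_pos hnR (by linarith)
    -- The estimator is exact at the unperturbed eigenvalues. Its error is at most `nδ / (n(s - 1))
    -- ≤ 2δ/s`, using `s ≥ 2`.
    have h2 : pHat hA m - (Δ + Q) = (s * (eig hA 1 - (s * Δ + n * Q - (Δ + Q))) +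
        (n - s) * (eig hA 2 - (s * Δ - (Δ + Q)))) / (n * (s - 1)) := by
      rw [pHat, hsHat, eq_div_iff h1.ne', sub_mul, div_mul_cancel₀ _ h1.ne']
      ring
    have h3 : |s * (eig hA 1 - (s * Δ + n * Q - (Δ + Q))) +
        (n - s) * (eig hA 2 - (s * Δ - (Δ + Q)))| ≤ n * δ := by
      rw [abs_le]
      constructor <;> nlinarith
    rw [h2, abs_div, abs_of_pos h1, div_le_div_iff₀ h1 hs0]
    calc _ ≤ n * δ * s := by gcongr
      _ ≤ 2 * δ * (n * (s - 1)) := by nlinarith [mul_pos hnR hδ]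
  have hq : |qHat hA - Q| ≤ 2 * δ / s := by
    have h2 : qHat hA - Q = (eig hA 1 - eig hA 2 - n * Q) / n := by
      rw [qHat, eq_div_iff hnR.ne', sub_mul, div_mul_cancel₀ _ hnR.ne']
      ring
    rw [h2, abs_div, abs_of_pos hnR]
    calc |eig hA 1 - eig hA 2 - n * Q| / n ≤ 2 * δ / n := by
          gcongr
          rw [abs_le]
          constructor <;> linarith
      _ ≤ 2 * δ / s := by gcongr
  -- The target interval is `Q + Δ/2 ± Δ/4`, and averaging two estimates does not increase the
  -- error; this is where `8δ ≤ sΔ` is sharp.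
  have hδs : 2 * δ / s ≤ Δ / 4 := by
    rw [div_le_div_iff₀ hs0 (by norm_num)]
    linarith
  refine ⟨⟨hmk, hsHat⟩, max_le hp hq, ?_⟩
  rw [abs_le] at hp hq
  rw [lambdaHat, Set.mem_Icc]
  constructor <;> linarith [hp.1, hp.2, hq.1, hq.2]

end BlockSpectrum

/-! ### Consequences of the density gap and the entries of the mean matrix -/

section Recovery

variable {n d k s : ℕ} {p q : ℝ} {Φ : Fin n → Fin k}

/-- The gap condition forces its right side to be at least `2p`, whereas for `s ≤ 1` that side is at
most `p² ≤ p`; truncated subtraction makes the binomial at `s = 1` at most 1. -/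
theorem GapCondition.two_le {c : ℝ} (hgap : GapCondition c n d s p q) (hc : 1 ≤ c) (hd : 2 ≤ d)
    (hdn : d ≤ n) (hq : 0 ≤ q) (hqp : q < p) (hp1 : p ≤ 1) : 2 ≤ s := by
  have hp : 0 < p := hq.trans_lt hqp
  have hn : (2 : ℝ) ≤ n := by exact_mod_cast hd.trans hdn
  have hN : (1 : ℝ) ≤ ((n - 2).choose (d - 2) : ℝ) := by
    exact_mod_cast Nat.choose_pos (by omega : d - 2 ≤ n - 2)
  have hlog : 0 < Real.log n := Real.log_pos (by linarith)
  have hlow : p * 2 ≤ c * (((n - 2).choose (d - 2) : ℝ) * p * (s * Real.log n + n)) := by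
    have h1 : p * 2 ≤ 1 * (1 * p * (0 + 2)) := by linarith
    refine h1.trans ?_
    gcongr
    positivity
  have hle := hlow.trans hgap
  by_contra! hs
  interval_cases s
  · norm_num at hle
    linarith
  · have h1 : (((1 - 2 : ℕ).choose (d - 2) : ℕ) : ℝ) ≤ 1 := by
      have : (1 - 2 : ℕ).choose (d - 2) ≤ 1 := by
        rcases Nat.eq_zero_or_pos (d - 2) with h | h
        · simp [h]
        · rw [Nat.choose_eq_zero_of_lt (by omega)]; omega
      exact_mod_cast this
    have h0 : (0 : ℝ) ≤ (((1 - 2 : ℕ).choose (d - 2) : ℕ) : ℝ) := Nat.cast_nonneg _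
    have h2 : ((1 : ℕ) : ℝ) ^ 2 * (((1 - 2 : ℕ).choose (d - 2) : ℕ) : ℝ) ^ 2 * (p - q) ^ 2 ≤
        1 ^ 2 * 1 ^ 2 * p ^ 2 := by
      gcongr
      · simp
      · linarith
    nlinarith

/-- Keeping only the `s log n` term, bounding `p - q` by `p` and cancelling gives `log n ≤ s
C(n-2,d-2) p`, which makes the spectral bound applicable. -/
theorem GapCondition.log_le {c : ℝ} (hgap : GapCondition c n d s p q) (hc : 1 ≤ c)
    (hdn : d ≤ n) (hsn : s ≤ n) (hs : 0 < s) (hq : 0 ≤ q) (hqp : q < p) :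
    Real.log n ≤ n * ((n - 2).choose (d - 2) : ℝ) * p := by
  have hp : 0 < p := hq.trans_lt hqp
  have hN : (0 : ℝ) < ((n - 2).choose (d - 2) : ℝ) := by
    exact_mod_cast Nat.choose_pos (by omega : d - 2 ≤ n - 2)
  have hs0 : (0 : ℝ) < s := by exact_mod_cast hs
  have hsn' : (s : ℝ) ≤ n := by exact_mod_cast hsn
  have hlog : 0 ≤ Real.log n := Real.log_natCast_nonneg n
  have hchoose : ((s - 2).choose (d - 2) : ℝ) ≤ ((n - 2).choose (d - 2) : ℝ) := by
    exact_mod_cast Nat.choose_le_choose _ (by omega)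
  have h1 : ((n - 2).choose (d - 2) : ℝ) * p * s * Real.log n ≤
      ((n - 2).choose (d - 2) : ℝ) * p * s * (s * ((n - 2).choose (d - 2) : ℝ) * p) := by
    calc ((n - 2).choose (d - 2) : ℝ) * p * s * Real.log n
        = 1 * (((n - 2).choose (d - 2) : ℝ) * p * (s * Real.log n + 0)) := by ring
      _ ≤ c * (((n - 2).choose (d - 2) : ℝ) * p * (s * Real.log n + n)) := by
        gcongr
        positivity
      _ ≤ (s : ℝ) ^ 2 * ((s - 2).choose (d - 2) : ℝ) ^ 2 * (p - q) ^ 2 := hgap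
      _ ≤ (s : ℝ) ^ 2 * ((n - 2).choose (d - 2) : ℝ) ^ 2 * p ^ 2 := by
        gcongr
        · linarith
      _ = _ := by ring
  refine (le_of_mul_le_mul_left h1 (by positivity)).trans ?_
  gcongr

variable {Ω : Type*} [MeasurableSpace Ω] {μ : Measure Ω} {W : Edge n d → Ω → ℝ}

theorem homogeneous_iff_subset {i : Fin n} {e : Edge n d} (hi : i ∈ e.1) :
    Homogeneous Φ e ↔ e.1 ⊆ Finset.univ.filter fun l => Φ l = Φ i := by
  constructor
  · intro h l hl
    exact Finset.mem_filter.2 ⟨Finset.mem_univ _, h l hl i hi⟩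
  · intro h a ha b hb
    rw [(Finset.mem_filter.1 (h ha)).2, (Finset.mem_filter.1 (h hb)).2]

theorem IsSample.similarity_mean_of_eq (h : IsSample μ p q Φ W) (hd : 2 ≤ d)
    (hb : Balanced Φ s) {i j : Fin n} (hij : i ≠ j) (hΦ : Φ i = Φ j) :
    similarity (fun e => ∫ ω, W e ω ∂μ) i j =
      ((s - 2).choose (d - 2) : ℝ) * (p - q) + ((n - 2).choose (d - 2) : ℝ) * q := by
  classical
  have h1 : ∀ e ∈ Finset.univ.filter (fun e : Edge n d => i ∈ e.1 ∧ j ∈ e.1),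
      ∫ ω, W e ω ∂μ =
        (if e.1 ⊆ Finset.univ.filter (fun l => Φ l = Φ i) then p - q else 0) + q := by
    intro e he
    have hi := (Finset.mem_filter.1 he).2.1
    split_ifs with hsub
    · rw [h.mean_homogeneous e ((homogeneous_iff_subset hi).2 hsub)]
      ring
    · rw [h.mean_heterogeneous e fun hh => hsub ((homogeneous_iff_subset hi).1 hh)]
      ring
  simp only [similarity, Matrix.of_apply]
  rw [if_neg hij, Finset.sum_congr rfl h1, Finset.sum_add_distrib, ← Finset.sum_filter,
    Finset.filter_filter, Finset.sum_const, Finset.sum_const, card_filter_pair hd hij,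
    card_filter_pair_subset hd _ hij (by simp) (by simp [hΦ]), hb (Φ i), nsmul_eq_mul,
    nsmul_eq_mul]

theorem IsSample.similarity_mean_of_ne (h : IsSample μ p q Φ W) (hd : 2 ≤ d)
    {i j : Fin n} (hΦ : Φ i ≠ Φ j) :
    similarity (fun e => ∫ ω, W e ω ∂μ) i j = ((n - 2).choose (d - 2) : ℝ) * q := by
  have hij : i ≠ j := fun hij => hΦ (by rw [hij])
  simp only [similarity, Matrix.of_apply]
  rw [if_neg hij, Finset.sum_congr rfl (g := fun _ => q), Finset.sum_const,
    card_filter_pair hd hij, nsmul_eq_mul]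
  intro e he
  obtain ⟨hi, hj⟩ := (Finset.mem_filter.1 he).2
  exact h.mean_heterogeneous e fun hh => hΦ (hh i hi j hj)

variable [IsProbabilityMeasure μ]

/-- All the entries concerned are equal; `s ≥ 2` supplies a pair, so that the infimum is not the
default value over an empty type. -/
theorem IsSample.minWithin_eq (h : IsSample μ p q Φ W) (hd : 2 ≤ d) (hb : Balanced Φ s)
    (hs : 2 ≤ s) (hk : 0 < k) :
    minWithin μ Φ W =
      ((s - 2).choose (d - 2) : ℝ) * (p - q) + ((n - 2).choose (d - 2) : ℝ) * q := by
  obtain ⟨i, hi, j, hj, hij⟩ :=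
    Finset.one_lt_card.1 (lt_of_lt_of_eq (show 1 < s by omega) (hb ⟨0, hk⟩).symm)
  have hne : Nonempty {x : Fin n × Fin n // x.1 ≠ x.2 ∧ Φ x.1 = Φ x.2} :=
    ⟨⟨(i, j), hij, by rw [(Finset.mem_filter.1 hi).2, (Finset.mem_filter.1 hj).2]⟩⟩
  rw [minWithin, iInf_congr fun x => by
    rw [h.meanSimilarity_eq, h.similarity_mean_of_eq hd hb x.2.1 x.2.2], ciInf_const]

theorem IsSample.maxCross_eq (h : IsSample μ p q Φ W) (hd : 2 ≤ d) (hb : Balanced Φ s)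
    (hs : 0 < s) (hk : 2 ≤ k) :
    maxCross μ Φ W = ((n - 2).choose (d - 2) : ℝ) * q := by
  obtain ⟨i, hi⟩ := Finset.card_pos.1 (hs.trans_eq (hb ⟨0, by omega⟩).symm)
  obtain ⟨j, hj⟩ := Finset.card_pos.1 (hs.trans_eq (hb ⟨1, by omega⟩).symm)
  have hne : Nonempty {x : Fin n × Fin n // Φ x.1 ≠ Φ x.2} :=
    ⟨⟨(i, j), by
      rw [(Finset.mem_filter.1 hi).2, (Finset.mem_filter.1 hj).2]
      simp⟩⟩
  rw [maxCross, iSup_congr fun x => by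
    rw [h.meanSimilarity_eq, h.similarity_mean_of_ne hd x.2], ciSup_const]

end Recovery

end WHSBM

/-! ### The main theorem -/

theorem theorem4p2 (d : ℕ) (hd : 2 ≤ d) :
    ∃ c₅ : ℝ, 0 < c₅ ∧ WHSBM.IsSpectralConstant.{u} d 1 c₅ ∧
      ∃ c₂ : ℝ, 0 < c₂ ∧
        ∀ (n k s : ℕ) (p q : ℝ) (Φ : Fin n → Fin k)
          (Ω : Type u) [MeasurableSpace Ω] (μ : Measure Ω) [IsProbabilityMeasure μ]
          (W : WHSBM.Edge n d → Ω → ℝ) (kHat : Ω → ℕ),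
          d ≤ n → 2 ≤ k → 0 ≤ q → q < p → p ≤ 1 →
          WHSBM.Balanced Φ s →
          WHSBM.IsSample μ p q Φ W →
          WHSBM.GapCondition c₂ n d s p q →
          -- the tie-breaking rule is arbitrary and may use extra randomness carried by `Ω`
          Measurable kHat →
          (∀ ω, kHat ω ∈ WHSBM.gapArgmax (WHSBM.similarity_isHermitian fun e => W e ω)) →
          1 - 4 * ((n : ℝ) ^ 11)⁻¹ <
            μ.real {ω |
              (kHat ω = k ∧ WHSBM.sHat n (kHat ω) = s) ∧
              max
                |WHSBM.pHat (WHSBM.similarity_isHermitian fun e => W e ω) (kHat ω)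
                  - WHSBM.minWithin μ Φ W|
                |WHSBM.qHat (WHSBM.similarity_isHermitian fun e => W e ω)
                  - WHSBM.maxCross μ Φ W|
                ≤ 2 * c₅ / s * √(n * ((n - 2).choose (d - 2) : ℝ) * p) ∧
              WHSBM.lambdaHat (WHSBM.similarity_isHermitian fun e => W e ω) (kHat ω) ∈
                Set.Icc (1 / 4 * WHSBM.minWithin μ Φ W + 3 / 4 * WHSBM.maxCross μ Φ W)
                  (3 / 4 * WHSBM.minWithin μ Φ W + 1 / 4 * WHSBM.maxCross μ Φ W)} := by
  obtain ⟨c₅, hc₅, hspec⟩ : ∃ c₅ : ℝ, 0 < c₅ ∧ WHSBM.IsSpectralConstant.{u} d 1 c₅ :=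
    ⟨_, WHSBM.spectralConst_pos d, WHSBM.isSpectralConstant_spectralConst hd⟩
  -- `64 c₅²` is the square of the factor in `8δ ≤ sΔ` with `δ = c₅√D`; the `+ 1` ensures a constant
  -- of at least 1, as the lemmas on the gap condition require.
  refine ⟨c₅, hc₅, hspec, 64 * c₅ ^ 2 + 1, by positivity, ?_⟩
  intro n k s p q Φ Ω _ μ _ W kHat hdn hk hq hqp hp1 hb h hgap _ hkHat
  have hc : 1 ≤ 64 * c₅ ^ 2 + 1 := by nlinarith
  have hs : 2 ≤ s := hgap.two_le hc hd hdn hq hqp hp1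
  have hks := hb.mul_eq
  have hsn : s ≤ n := by nlinarith
  have hlog := hgap.log_le hc hdn hsn (by omega) hq hqp
  have hp : 0 < p := hq.trans_lt hqp
  have hnR : (2 : ℝ) ≤ n := by exact_mod_cast hd.trans hdn
  obtain ⟨D, hD⟩ : ∃ D, D = n * ((n - 2).choose (d - 2) : ℝ) * p := ⟨_, rfl⟩
  have hD0 : 0 < D := by rw [hD]; exact (Real.log_pos (by linarith)).trans_le hlog
  have hr : 0 < √D := Real.sqrt_pos.2 hD0
  -- On the event of the spectral bound all conclusions hold deterministically, for every
  -- tie-breaking rule.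
  refine (hspec n k p q Φ Ω μ W hdn hq hqp hp1 h (by rwa [one_mul])).trans_le
    (MeasureTheory.measureReal_mono fun ω hω => ?_)
  rw [Set.mem_ofPred_eq, ← hD] at hω
  rw [Set.mem_ofPred_eq, ← hD, h.minWithin_eq hd hb hs (by omega),
    h.maxCross_eq hd hb (by omega) hk]
  have hδ : 2 * c₅ / s * √D = 2 * (c₅ * √D) / s := by ring
  rw [hδ]
  have hΔ : 0 ≤ ((s - 2).choose (d - 2) : ℝ) * (p - q) :=
    mul_nonneg (Nat.cast_nonneg _) (by linarith)
  refine WHSBM.estimators_of_nearBlockForm (δ := c₅ * √D) _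
    (WHSBM.nearBlockForm_of_spectralNorm_le (Φ := Φ) hω ?_ ?_ ?_) hb hk hs (by positivity)
    (by positivity) ?_ (hkHat ω)
  · intro i
    rw [h.meanSimilarity_eq]
    simp [WHSBM.similarity]
  · intro i j hij hΦ
    rw [h.meanSimilarity_eq, h.similarity_mean_of_eq hd hb hij hΦ]
  · intro i j hΦ
    rw [h.meanSimilarity_eq, h.similarity_mean_of_ne hd hΦ]
  · refine le_of_sq_le_sq ?_ (by positivity)
    have hN : (0 : ℝ) ≤ ((n - 2).choose (d - 2) : ℝ) := Nat.cast_nonneg _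
    have hl := Real.log_natCast_nonneg n
    calc (8 * (c₅ * √D)) ^ 2 = 64 * c₅ ^ 2 * √D ^ 2 := by ring
      _ = 64 * c₅ ^ 2 * (((n - 2).choose (d - 2) : ℝ) * p * (0 + n)) := by
        rw [Real.sq_sqrt hD0.le, hD]; ring
      _ ≤ (64 * c₅ ^ 2 + 1) * (((n - 2).choose (d - 2) : ℝ) * p * (s * Real.log n + n)) := by
        gcongr
        · linarith
        · positivity
      _ ≤ (s : ℝ) ^ 2 * ((s - 2).choose (d - 2) : ℝ) ^ 2 * (p - q) ^ 2 := hgap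
      _ = (s * (((s - 2).choose (d - 2) : ℝ) * (p - q))) ^ 2 := by ring
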